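/- Let $N\ge 1$, let $\alpha_1,\dots,\alpha_N>-1$ be real numbers with $\alpha_i-\alpha_j\in\mathbb{Z}$ for all $i,j$, and let $a_1,\dots,a_{N-1}\in\mathbb{R}\setminus\{0\}$. Let $E_{i,j}$ denote the $N\times N$ matrix units, and put $$A=\sum_{j=1}^{\lfloor N/2\rfloor}a_{2j-1}E_{2j-1,2j}+\sum_{j=1}^{\lfloor (N-1)/2\rfloor}a_{2j}E_{2j+1,2j},\qquad T(x)=e^{Ax}=I+Ax .$$ Let $w_\alpha(x)=e^{-x}x^{\alpha}$ for $x>0$ and $w_\alpha(x)=0$ for $x\le 0$. Then the weight matrix $$W(x)=T(x)\,\operatorname{diag}(w_{\alpha_1}(x),\dots,w_{\alpha_N}(x))\,T(x)^{*}$$ is a Darboux transformation of the diagonal weight matrix $\widetilde W(x)=\operatorname{diag}(w_{\alpha_1}(x),\dots,w_{\alpha_N}(x))$. Here the following definitions are used. A weight matrix of size $N$ supported on an interval $(x_0,x_1)$, $-\infty\le x_0<x_1\le\infty$, is an integrable function $V:\mathbb{R}\to\operatorname{Mat}_N(\mathbb{C})$ that is positive definite almost everywhere in $(x_0,x_1)$,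 vanishes outside $(x_0,x_1)$, and has finite moments $\int x^nV(x)\,dx$ for all $n\ge 0$. A sequence of orthogonal polynomials for $V$ is a sequence $(Q_n)_{n\ge 0}$ in $\operatorname{Mat}_N(\mathbb{C}[x])$ such that $Q_n$ has degree $n$ and nonsingular leading coefficient, and $\int Q_n(x)V(x)Q_m(x)^{*}dx=0$ for $n\neq m$. Differential operators $D=\sum_{j=0}^m\partial^jF_j(x)$, with $F_j\in\operatorname{Mat}_N(\mathbb{C}[x])$, act on matrix polynomials from the right by $P\cdot D=\sum_j\partial^j(P)F_j$, and products are formed so that $P\cdot(D_1D_2)=(P\cdot D_1)\cdot D_2$. $\mathcal{D}(V)$ is the set of all such $D$ for which $Q_n\cdot D=\Lambda_nQ_n$ for all $n\ge 0$ with some $\Lambda_n\in\operatorname{Mat}_N(\mathbb{C})$, where $(Q_n)$ is a sequence of orthogonal polynomials for $V$ (the choice of the sequence does not matter). An operator $D$ is degree-preserving if, for all but finitely many $n$, it maps every $P\in\operatorname{Mat}_N(\mathbb{C}[x])$ of degree $n$ to a matrix polynomial of degree $n$. For weight matrices $V,\widetilde V$ of size $N$ with sequences of orthogonal polynomials $(Q_n),(\widetilde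 Q_n)$, we say that $\widetilde V$ is a Darboux transformation of $V$ if there is $D\in\mathcal{D}(V)$ with a factorization $D=D_1D_2$ into degree-preserving differential operators $D_1,D_2$ such that $Q_n\cdot D_1=A_n\widetilde Q_n$ for all $n\ge 0$, with constant matrices $A_n\in\operatorname{Mat}_N(\mathbb{C})$. -/

import Mathlib

/-- Matrix polynomials `Mat_N(ℂ[x])`. -/
abbrev MatPoly (N : ℕ) : Type := Matrix (Fin N) (Fin N) (Polynomial ℂ)

namespace MatPoly

variable {N : ℕ}

/-- The value `P(x) ∈ Mat_N(ℂ)` at a real point `x`. -/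
noncomputable def evalAt (P : MatPoly N) (x : ℝ) : Matrix (Fin N) (Fin N) ℂ :=
  P.map (Polynomial.eval (x : ℂ))

/-- The matrix coefficient of `x ^ k` in `P`. -/
noncomputable def coeffMat (P : MatPoly N) (k : ℕ) : Matrix (Fin N) (Fin N) ℂ :=
  P.map (fun p => p.coeff k)

/-- A constant matrix regarded as a matrix polynomial. -/
noncomputable def const (M : Matrix (Fin N) (Fin N) ℂ) : MatPoly N :=
  M.map Polynomial.C

/-- The derivative `∂ ^ j (P)`, taken entrywise. -/
noncomputable def deriv (j : ℕ) (P : MatPoly N) : MatPoly N :=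
  P.map (fun p => Polynomial.derivative^[j] p)

/-- `P` is a polynomial of degree exactly `n`: its leading coefficient is a nonzero matrix. -/
def HasDegree (P : MatPoly N) (n : ℕ) : Prop :=
  P.coeffMat n ≠ 0 ∧ ∀ k, n < k → P.coeffMat k = 0

/-- `P` is a polynomial of degree `n` whose leading coefficient is a nonsingular matrix. -/
def HasRegularDegree (P : MatPoly N) (n : ℕ) : Prop :=
  IsUnit (P.coeffMat n) ∧ ∀ k, n < k → P.coeffMat k = 0

theorem deriv_add (j : ℕ) (P Q : MatPoly N) :
    deriv j (P + Q) = deriv j P + deriv j Q := by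
  ext1 a b
  simp [deriv]

theorem deriv_zero (j : ℕ) : deriv j (0 : MatPoly N) = 0 := by
  ext1 a b
  simp [deriv]

theorem deriv_deriv (i j : ℕ) (P : MatPoly N) : deriv j (deriv i P) = deriv (j + i) P := by
  ext1 a b
  simp [deriv, Function.iterate_add_apply]

theorem deriv_mul (n : ℕ) (P Q : MatPoly N) :
    deriv n (P * Q) =
      ∑ k ∈ Finset.range (n + 1), n.choose k • (deriv k P * deriv (n - k) Q) := by
  ext1 a b
  simp only [deriv, Matrix.map_apply, Matrix.mul_apply, Matrix.sum_apply, Matrix.smul_apply]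
  rw [Polynomial.iterate_derivative_sum]
  simp_rw [Polynomial.iterate_derivative_mul, Finset.smul_sum]
  rw [Finset.sum_comm]
  rw [← Finset.sum_range_reflect]
  refine Finset.sum_congr rfl fun k hk => Finset.sum_congr rfl fun c _ => ?_
  have hk' : k ≤ n := by simpa [Nat.lt_succ_iff] using hk
  have h1 : n + 1 - 1 - k = n - k := by omega
  have h2 : n - (n - k) = k := by omega
  rw [h1, h2, Nat.choose_symm hk']

end MatPoly

/-- A differential operator `D = ∑ j, ∂ ^ j F_j(x)`, given by its finitely many nonzero
coefficients `F_j`. The coefficients are matrix polynomials: an operator that sends matrix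
polynomials to matrix polynomials, as all operators below have to, has polynomial coefficients. -/
abbrev MatDiffOp (N : ℕ) : Type := ℕ →₀ MatPoly N

namespace MatDiffOp

variable {N : ℕ}

/-- The right-hand side action `P · D = ∑ j, ∂ ^ j (P) F_j`. -/
noncomputable def act (P : MatPoly N) (D : MatDiffOp N) : MatPoly N :=
  D.sum fun j F => P.deriv j * F

/-- The product `D₁ D₂`: first `D₁` acts on the right, then `D₂` does. By the Leibniz rule
`∂ ^ i F ∂ ^ j G = ∑ k, (j choose k) ∂ ^ (i + k) (∂ ^ (j - k) F) G`; see `act_comp`. -/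
noncomputable def comp (D₁ D₂ : MatDiffOp N) : MatDiffOp N :=
  D₁.sum fun i F => D₂.sum fun j G =>
    ∑ k ∈ Finset.range (j + 1), Finsupp.single (i + k) (j.choose k • (F.deriv (j - k) * G))

theorem act_zero (P : MatPoly N) : act P 0 = 0 := by simp [act]

theorem act_add (P : MatPoly N) (D E : MatDiffOp N) : act P (D + E) = act P D + act P E := by
  unfold act
  exact Finsupp.sum_add_index' (fun _ => mul_zero _) (fun _ _ _ => mul_add _ _ _)

theorem act_single (P : MatPoly N) (j : ℕ) (F : MatPoly N) :
    act P (Finsupp.single j F) = P.deriv j * F := by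
  unfold act
  exact Finsupp.sum_single_index (mul_zero _)

theorem act_sum {ι : Type*} (P : MatPoly N) (s : Finset ι) (D : ι → MatDiffOp N) :
    act P (∑ i ∈ s, D i) = ∑ i ∈ s, act P (D i) := by
  classical
  induction s using Finset.induction_on with
  | empty => simp [act_zero]
  | insert i s hi ih => rw [Finset.sum_insert hi, Finset.sum_insert hi, act_add, ih]

theorem deriv_sum {ι : Type*} (j : ℕ) (s : Finset ι) (P : ι → MatPoly N) :
    MatPoly.deriv j (∑ i ∈ s, P i) = ∑ i ∈ s, MatPoly.deriv j (P i) := by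
  classical
  induction s using Finset.induction_on with
  | empty => simp [MatPoly.deriv_zero]
  | insert i s hi ih => rw [Finset.sum_insert hi, Finset.sum_insert hi, MatPoly.deriv_add, ih]

theorem act_comp (P : MatPoly N) (D₁ D₂ : MatDiffOp N) :
    act P (comp D₁ D₂) = act (act P D₁) D₂ := by
  unfold comp
  rw [Finsupp.sum, act_sum]
  conv_rhs => rw [act, Finsupp.sum]
  simp_rw [Finsupp.sum, act_sum, act_single]
  rw [Finset.sum_comm]
  refine Finset.sum_congr rfl fun j _ => ?_
  rw [act, Finsupp.sum, deriv_sum, Finset.sum_mul]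
  refine Finset.sum_congr rfl fun i _ => ?_
  rw [MatPoly.deriv_mul, Finset.sum_mul]
  refine Finset.sum_congr rfl fun k _ => ?_
  rw [MatPoly.deriv_deriv, mul_smul_comm, smul_mul_assoc, mul_assoc, add_comm i k]

/-- `D` is degree-preserving: for all but finitely many `n`, it maps every matrix polynomial of
degree `n` to a matrix polynomial of degree `n`. -/
def IsDegreePreserving (D : MatDiffOp N) : Prop :=
  ∀ᶠ n : ℕ in Filter.cofinite, ∀ P : MatPoly N, P.HasDegree n → (act P D).HasDegree n

end MatDiffOp

section Weights

open scoped ComplexOrder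

variable {N : ℕ}

/-- `W` is a weight matrix supported on the (bounded or unbounded) interval `(x₀, x₁)`. -/
structure IsWeightMatrixOn (x₀ x₁ : EReal) (W : ℝ → Matrix (Fin N) (Fin N) ℂ) : Prop where
  lt : x₀ < x₁
  posDef : ∀ᵐ x : ℝ, x₀ < (x : EReal) → (x : EReal) < x₁ → (W x).PosDef
  eq_zero : ∀ x : ℝ, ¬ (x₀ < (x : EReal) ∧ (x : EReal) < x₁) → W x = 0
  /-- All moments are finite; for `n = 0` this is the integrability of `W`. -/
  integrable : ∀ (n : ℕ) (i j : Fin N),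
    MeasureTheory.Integrable (fun x : ℝ => (x : ℂ) ^ n * W x i j)

/-- `W` is a weight matrix of size `N`. -/
def IsWeightMatrix (W : ℝ → Matrix (Fin N) (Fin N) ℂ) : Prop :=
  ∃ x₀ x₁ : EReal, IsWeightMatrixOn x₀ x₁ W

/-- The matrix-valued inner product `⟨P, Q⟩ = ∫ P(x) W(x) Q(x)^* dx`. As `W` vanishes outside its
interval, the integral is taken over all of `ℝ`. -/
noncomputable def weightInner (W : ℝ → Matrix (Fin N) (Fin N) ℂ) (P Q : MatPoly N) :
    Matrix (Fin N) (Fin N) ℂ :=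
  Matrix.of fun i j => ∫ x : ℝ, (P.evalAt x * W x * (Q.evalAt x).conjTranspose) i j

/-- `Q` is a sequence of orthogonal polynomials for `W`. -/
structure IsOrthogonalSequence (W : ℝ → Matrix (Fin N) (Fin N) ℂ) (Q : ℕ → MatPoly N) :
    Prop where
  degree : ∀ n, (Q n).HasRegularDegree n
  orthogonal : ∀ n m, n ≠ m → weightInner W (Q n) (Q m) = 0

/-- The algebra `𝒟(W)` of the differential operators that have a sequence of orthogonal
polynomials for `W` as eigenfunctions. Two such sequences differ by left multiplication by
nonsingular constant matrices, so that the choice of the sequence is immaterial. -/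
def diffOpAlgebra (W : ℝ → Matrix (Fin N) (Fin N) ℂ) : Set (MatDiffOp N) :=
  {D | ∃ Q : ℕ → MatPoly N, IsOrthogonalSequence W Q ∧
    ∃ Λ : ℕ → Matrix (Fin N) (Fin N) ℂ, ∀ n,
      MatDiffOp.act (Q n) D = MatPoly.const (Λ n) * Q n}

/-- `IsDarbouxTransformation V W`: the weight matrix `V` is a Darboux transformation of the weight
matrix `W`. The choice of the sequences of orthogonal polynomials `Q` for `W` and `R` for `V` is
immaterial, as in `diffOpAlgebra`. -/
def IsDarbouxTransformation (V W : ℝ → Matrix (Fin N) (Fin N) ℂ) : Prop :=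
  IsWeightMatrix V ∧ IsWeightMatrix W ∧
    ∃ D ∈ diffOpAlgebra W, ∃ D₁ D₂ : MatDiffOp N,
      D = MatDiffOp.comp D₁ D₂ ∧ D₁.IsDegreePreserving ∧ D₂.IsDegreePreserving ∧
      ∃ Q R : ℕ → MatPoly N, IsOrthogonalSequence W Q ∧ IsOrthogonalSequence V R ∧
        ∃ A : ℕ → Matrix (Fin N) (Fin N) ℂ, ∀ n,
          MatDiffOp.act (Q n) D₁ = MatPoly.const (A n) * R n

end Weights

/-- The scalar Laguerre weight `e^{-x} x^α`, supported on `(0, ∞)`. -/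
noncomputable def laguerreWeight (α : ℝ) (x : ℝ) : ℝ :=
  if 0 < x then Real.exp (-x) * x ^ α else 0

/-- The diagonal weight `diag(w_{α_1}(x), …, w_{α_N}(x))`. -/
noncomputable def laguerreDiag {N : ℕ} (α : Fin N → ℝ) (x : ℝ) : Matrix (Fin N) (Fin N) ℂ :=
  Matrix.diagonal fun i => (laguerreWeight (α i) x : ℂ)

/-- The matrix `A = ∑ a_{2j-1} E_{2j-1,2j} + ∑ a_{2j} E_{2j+1,2j}`. The parameters `a 1, …, a (N-1)`
are numbered from one, while the rows and columns are numbered from zero here, so that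
`E_{2j-1,2j}` stands in row `2j-2`, column `2j-1`, and `E_{2j+1,2j}` in row `2j`, column `2j-1`. -/
noncomputable def zigzagMatrix (N : ℕ) (a : ℕ → ℝ) : Matrix (Fin N) (Fin N) ℂ :=
  Matrix.of fun r c =>
    if c.val % 2 = 1 ∧ r.val + 1 = c.val then (a c.val : ℂ)
    else if c.val % 2 = 1 ∧ r.val = c.val + 1 then (a r.val : ℂ)
    else 0

/-- `T(x) = e^{A x}`, which equals `I + A x`, see `zigzagExp_eq`. -/
noncomputable def zigzagExp (N : ℕ) (a : ℕ → ℝ) (x : ℝ) : Matrix (Fin N) (Fin N) ℂ :=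
  NormedSpace.exp ((x : ℂ) • zigzagMatrix N a)

theorem zigzagMatrix_mul_self (N : ℕ) (a : ℕ → ℝ) :
    zigzagMatrix N a * zigzagMatrix N a = 0 := by
  ext r c
  rw [Matrix.mul_apply, Matrix.zero_apply]
  refine Finset.sum_eq_zero fun k _ => ?_
  simp only [zigzagMatrix, Matrix.of_apply]
  split_ifs <;> first | omega | simp

theorem zigzagExp_eq (N : ℕ) (a : ℕ → ℝ) (x : ℝ) :
    zigzagExp N a x = 1 + (x : ℂ) • zigzagMatrix N a := by
  have h : ((x : ℂ) • zigzagMatrix N a) ^ 2 = 0 := by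
    rw [pow_two, smul_mul_smul_comm, zigzagMatrix_mul_self, smul_zero]
  unfold zigzagExp
  rw [NormedSpace.exp_eq_tsum ℂ]
  simp only []
  rw [tsum_eq_sum (s := Finset.range 2)]
  · simp [Finset.sum_range_succ]
  · intro n hn
    have hn' : 2 ≤ n := by simpa [Nat.succ_le_iff] using hn
    rw [pow_eq_zero_of_le hn' h, smul_zero]

/-- The weight `W(x) = T(x) diag(e^{-x} x^{α_1}, …, e^{-x} x^{α_N}) T(x)^*`. -/
noncomputable def laguerreTypeWeight {N : ℕ} (α : Fin N → ℝ) (a : ℕ → ℝ) (x : ℝ) :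
    Matrix (Fin N) (Fin N) ℂ :=
  zigzagExp N a x * laguerreDiag α x * (zigzagExp N a x).conjTranspose

/-!
Write `T = 1 + X A` and let `M n` be the diagonal matrix of the monic Laguerre polynomials
`L_n^{α_i}`, with squared norms `H n`. Right multiplication by `T` is an isometry from the matrix
polynomials with the inner product of `W = T diag(w) T^*` to those with the inner product of the
diagonal weight. The nonzero entries of `A` stand in the rows of one parity class and in the columns
of the other one, so that `A D A = 0` for every diagonal `D`. Therefore
`S n = M n + A M (n + 1) - H n A^* (H (n - 1))⁻¹ M (n - 1)` is an orthogonal sequence for the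
diagonal weight (`weightInner_shearedLaguerre`). The terms of degree `n + 1` of
`R n = S n (1 - X A)` cancel, and its leading coefficient is the product of a unipotent matrix and of
`1 + H n A^* (H (n - 1))⁻¹ A`, which is invertible as a positive diagonal matrix times a positive
definite one. Hence `R` is a sequence of orthogonal polynomials for `W`
(`isOrthogonalSequence_shearedSequence`).

It remains to pass from `M` to `S` and back by differential operators. Let `α_i = γ + m_i` with
natural `m_i`, and let `∂` be the derivative. The scalar operators `1 - ∂` and `X ∂ + α + 1`
map Laguerre polynomials of parameter `α` to parameter `α + 1` and back. Composed with `∂`, which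
lowers the degree and raises the parameter, and with `X ∂ + α + 1 - X`, which takes parameter
`α + 1` to `α` and raises the degree, they map `L_n^{α_i}` to multiples of `L_{n ± 1}^{α_j}` and `L_n^{α_j}`, with factors polynomial in `n`;
polynomials in `n` themselves come from Laguerre's differential operator. All ratios of norms are
rational in `n` because the parameters differ by integers. After multiplication of the rows of `S n`
by suitable polynomials in `n` (`rowFactor`), `S n` thus becomes the image of `M n` under a
differential operator (`exists_shearing_operator`), and the adjoint expression maps `S n` to left
multiples of `M n` (`exists_unshearing_operator`, `act_shearedLaguerre`). Composing with `T⁻¹` and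
`T` gives the two factors. They preserve degrees because the constant matrices that occur are
invertible for all `n ≥ 1` (`MatDiffOp.isDegreePreserving_of_act_eq`).
-/

/-! ### Monic Laguerre polynomials and their moments -/

open Polynomial in
/-- The monic Laguerre polynomial of degree `n` with parameter `α`, defined for all real `α` by the
recursion that Rodrigues' formula gives. -/
noncomputable def monicLaguerre : ℕ → ℝ → ℂ[X]
  | 0, _ => 1
  | n + 1, α => (X - C ((α : ℂ) + 1)) * monicLaguerre n (α + 1)
      - X * derivative (monicLaguerre n (α + 1))

namespace monicLaguerre

open Polynomial

/-- Rodrigues' formula: the operator raises the degree and lowers the parameter. -/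
theorem raise (n : ℕ) (α : ℝ) :
    X * derivative (monicLaguerre n (α + 1)) + (C ((α : ℂ) + 1) - X) * monicLaguerre n (α + 1)
      = -monicLaguerre (n + 1) α := by
  simp only [monicLaguerre]; ring

theorem derivative_succ (n : ℕ) (α : ℝ) :
    derivative (monicLaguerre (n + 1) α) = ((n : ℂ[X]) + 1) * monicLaguerre n (α + 1) := by
  induction n generalizing α with
  | zero => simp [monicLaguerre]
  | succ n ih =>
    have h := raise n (α + 1)
    rw [monicLaguerre]
    simp only [derivative_sub, derivative_mul, derivative_X, derivative_C, ih]
    push_cast at h ⊢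
    simp only [derivative_add, derivative_natCast, derivative_one, C_add, C_1] at h ⊢
    linear_combination (-(n : ℂ[X]) - 1) * h

/-- The operator `1 - ∂` raises the parameter. -/
theorem sub_derivative (n : ℕ) (α : ℝ) :
    monicLaguerre n α - derivative (monicLaguerre n α) = monicLaguerre n (α + 1) := by
  induction n generalizing α with
  | zero => simp [monicLaguerre]
  | succ n ih =>
    have h := ih (α + 1)
    have h' := congrArg derivative h
    rw [monicLaguerre, monicLaguerre]
    simp only [derivative_sub, derivative_mul, derivative_X, derivative_C] at h' ⊢
    push_cast
    simp only [C_add, C_1]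
    rw [← h', ← h]
    ring

/-- Laguerre's differential equation. -/
theorem differential_equation (n : ℕ) (α : ℝ) :
    X * derivative (derivative (monicLaguerre n α))
      + (C ((α : ℂ) + 1) - X) * derivative (monicLaguerre n α)
      = -((n : ℂ[X]) * monicLaguerre n α) := by
  cases n with
  | zero => simp [monicLaguerre]
  | succ n =>
    rw [derivative_succ]
    simp only [derivative_mul, derivative_add, derivative_natCast, derivative_one]
    push_cast
    linear_combination ((n : ℂ[X]) + 1) * raise n α

theorem lower_parameter (n : ℕ) (α : ℝ) :
    X * derivative (monicLaguerre n (α + 1)) + C ((α : ℂ) + 1) * monicLaguerre n (α + 1)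
      = C ((n : ℂ) + α + 1) * monicLaguerre n α := by
  have h := differential_equation n α
  rw [← sub_derivative]
  simp only [derivative_sub, C_add, C_1, map_natCast] at h ⊢
  linear_combination -h

theorem natDegree_le (n : ℕ) (α : ℝ) : (monicLaguerre n α).natDegree ≤ n := by
  induction n generalizing α with
  | zero => simp [monicLaguerre]
  | succ n ih =>
    rw [monicLaguerre]
    refine (natDegree_sub_le _ _).trans (max_le ?_ ?_)
    · refine natDegree_mul_le.trans ?_
      rw [natDegree_X_sub_C, add_comm]
      exact Nat.add_le_add_right (ih _) 1
    · refine natDegree_mul_le.trans ?_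
      rw [natDegree_X, add_comm]
      exact Nat.add_le_add_right
        (((natDegree_derivative_le _).trans (Nat.sub_le _ _)).trans (ih _)) 1

theorem coeff_of_lt {n k : ℕ} (α : ℝ) (h : n < k) : (monicLaguerre n α).coeff k = 0 :=
  coeff_eq_zero_of_natDegree_lt ((natDegree_le n α).trans_lt h)

theorem coeff_self (n : ℕ) (α : ℝ) : (monicLaguerre n α).coeff n = 1 := by
  induction n generalizing α with
  | zero => simp [monicLaguerre]
  | succ n ih =>
    rw [monicLaguerre, coeff_sub, sub_mul, coeff_sub, coeff_X_mul, coeff_X_mul, coeff_C_mul,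
      coeff_derivative, ih, coeff_of_lt _ (Nat.lt_succ_self n)]
    simp

/-- Laguerre polynomials have real coefficients. -/
theorem map_conj (n : ℕ) (α : ℝ) :
    (monicLaguerre n α).map (starRingEnd ℂ) = monicLaguerre n α := by
  induction n generalizing α with
  | zero => simp [monicLaguerre]
  | succ n ih =>
    simp only [monicLaguerre, Polynomial.map_sub, Polynomial.map_mul, map_X, map_C,
      ← derivative_map, ih]
    simp

end monicLaguerre

open Polynomial in
/-- The moment functional `p ↦ ∫₀^∞ p(x) e^{-x} x^α dx`, given by its values `Γ(α + k + 1)` on the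
powers `X ^ k`. -/
noncomputable def laguerreMoment (α : ℝ) : ℂ[X] →ₗ[ℂ] ℂ :=
  Polynomial.lsum fun k => (LinearMap.id : ℂ →ₗ[ℂ] ℂ).smulRight ((Real.Gamma (α + k + 1) : ℝ) : ℂ)

/-- The squared norm of the monic Laguerre polynomial of degree `n`. -/
noncomputable def laguerreNorm (α : ℝ) (n : ℕ) : ℝ := n.factorial * Real.Gamma (α + n + 1)

section Moments

open Polynomial

theorem laguerreMoment_monomial (α : ℝ) (k : ℕ) (c : ℂ) :
    laguerreMoment α (monomial k c) = c * (Real.Gamma (α + k + 1) : ℝ) := by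
  simp [laguerreMoment, Polynomial.lsum_apply, sum_monomial_index]

theorem laguerreMoment_X_mul (α : ℝ) (p : ℂ[X]) :
    laguerreMoment α (X * p) = laguerreMoment (α + 1) p := by
  have : (laguerreMoment α).comp (LinearMap.mulLeft ℂ X) = laguerreMoment (α + 1) := by
    refine Polynomial.lhom_ext' fun k => LinearMap.ext_ring ?_
    simp only [LinearMap.comp_apply, LinearMap.mulLeft_apply, X_mul_monomial,
      laguerreMoment_monomial]
    push_cast
    congr 3; ring
  exact LinearMap.congr_fun this p

/-- The fundamental theorem of calculus for `p(x) e^{-x} x^{α+1}`, whose boundary values vanish. -/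
theorem laguerreMoment_exact {α : ℝ} (hα : -1 < α) (p : ℂ[X]) :
    laguerreMoment α (X * derivative p + (C ((α : ℂ) + 1) - X) * p) = 0 := by
  have : (laguerreMoment α).comp (LinearMap.mulLeft ℂ X ∘ₗ derivative
      + LinearMap.mulLeft ℂ (C ((α : ℂ) + 1) - X)) = 0 := by
    refine Polynomial.lhom_ext' fun k => LinearMap.ext_ring ?_
    have hk : α + k + 1 ≠ 0 := by
      have : (0 : ℝ) ≤ k := k.cast_nonneg
      linarith
    have hG := Real.Gamma_add_one hk
    have h : X * derivative (monomial k (1 : ℂ)) + (C ((α : ℂ) + 1) - X) * monomial k 1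
        = monomial k ((k : ℂ) + α + 1) - monomial (k + 1) 1 := by
      rw [derivative_monomial, sub_mul, C_mul_monomial, X_mul_monomial]
      cases k with
      | zero => simp [monomial_one_one_eq_X]
      | succ k =>
        rw [Nat.add_sub_cancel, X_mul_monomial, ← add_sub_assoc, ← map_add]
        congr 2
        push_cast
        ring
    simp only [LinearMap.comp_apply, LinearMap.add_apply, LinearMap.mulLeft_apply, h, map_sub,
      laguerreMoment_monomial, LinearMap.zero_apply]
    push_cast
    rw [show α + ((k : ℝ) + 1) + 1 = α + k + 1 + 1 by ring, hG]
    push_cast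
    ring
  exact LinearMap.congr_fun this p

/-- Integration by parts against a Laguerre polynomial. -/
theorem laguerreMoment_succ_mul {α : ℝ} (hα : -1 < α) (n : ℕ) (p : ℂ[X]) :
    laguerreMoment α (monicLaguerre (n + 1) α * p)
      = laguerreMoment (α + 1) (monicLaguerre n (α + 1) * derivative p) := by
  have h := laguerreMoment_exact hα (monicLaguerre n (α + 1) * p)
  rw [← laguerreMoment_X_mul, ← sub_eq_zero, ← neg_eq_zero, ← h, ← map_sub, ← map_neg,
    derivative_mul]
  congr 1
  linear_combination (-p) * monicLaguerre.raise n α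

theorem laguerreMoment_mul_monicLaguerre {α : ℝ} (hα : -1 < α) (n m : ℕ) :
    laguerreMoment α (monicLaguerre n α * monicLaguerre m α)
      = if n = m then (laguerreNorm α n : ℂ) else 0 := by
  induction n generalizing α m with
  | zero =>
    cases m with
    | zero =>
      have := laguerreMoment_monomial α 0 1
      simp only [monomial_zero_one] at this
      simp [monicLaguerre, laguerreNorm, this]
    | succ m =>
      rw [mul_comm, laguerreMoment_succ_mul hα]
      simp [monicLaguerre]
  | succ n ih =>
    cases m with
    | zero =>
      rw [laguerreMoment_succ_mul hα]
      simp [monicLaguerre]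
    | succ m =>
      rw [laguerreMoment_succ_mul hα, monicLaguerre.derivative_succ, mul_left_comm,
        show ((m : ℂ[X]) + 1) = C ((m : ℂ) + 1) by simp, ← smul_eq_C_mul, map_smul,
        ih (by linarith), smul_eq_mul]
      by_cases h : n = m
      · subst h
        simp only [if_true, laguerreNorm, Nat.factorial_succ]
        push_cast
        rw [show α + 1 + (n : ℝ) + 1 = α + (n + 1) + 1 by ring]
        ring
      · simp [h]

theorem laguerreNorm_pos {α : ℝ} (hα : -1 < α) (n : ℕ) : 0 < laguerreNorm α n := by
  have : (0 : ℝ) ≤ n := n.cast_nonneg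
  exact mul_pos (by exact_mod_cast n.factorial_pos) (Real.Gamma_pos_of_pos (by linarith))

theorem laguerreWeight_mul_pow_eq_indicator (α : ℝ) (k : ℕ) (x : ℝ) :
    x ^ k * laguerreWeight α x
      = (Set.Ioi 0).indicator (fun x => Real.exp (-x) * x ^ (α + k + 1 - 1)) x := by
  by_cases hx : 0 < x
  · rw [Set.indicator_of_mem (Set.mem_Ioi.2 hx), laguerreWeight, if_pos hx, add_sub_cancel_right,
      Real.rpow_add hx, Real.rpow_natCast]
    ring
  · rw [Set.indicator_of_notMem (by simpa using hx), laguerreWeight, if_neg hx, mul_zero]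

theorem hasIntegral_pow_mul_laguerreWeight {α : ℝ} (hα : -1 < α) (k : ℕ) :
    MeasureTheory.Integrable (fun x : ℝ => x ^ k * laguerreWeight α x) ∧
      ∫ x : ℝ, x ^ k * laguerreWeight α x = Real.Gamma (α + k + 1) := by
  have : (0 : ℝ) ≤ k := k.cast_nonneg
  have hk : 0 < α + k + 1 := by linarith
  simp_rw [laguerreWeight_mul_pow_eq_indicator]
  exact ⟨(MeasureTheory.integrable_indicator_iff measurableSet_Ioi).2
      (Real.GammaIntegral_convergent hk),
    by rw [MeasureTheory.integral_indicator measurableSet_Ioi, Real.Gamma_eq_integral hk]⟩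

/-- The moment functional is integration against the Laguerre weight. -/
theorem integral_eval_mul_laguerreWeight {α : ℝ} (hα : -1 < α) (p : ℂ[X]) :
    MeasureTheory.Integrable (fun x : ℝ => p.eval (x : ℂ) * (laguerreWeight α x : ℂ)) ∧
      ∫ x : ℝ, p.eval (x : ℂ) * (laguerreWeight α x : ℂ) = laguerreMoment α p := by
  induction p using Polynomial.induction_on' with
  | add p q hp hq =>
    simp only [eval_add, add_mul]
    exact ⟨hp.1.add hq.1, by rw [MeasureTheory.integral_add hp.1 hq.1, hp.2, hq.2, map_add]⟩
  | monomial k c =>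
    have h : (fun x : ℝ => (monomial k c).eval (x : ℂ) * (laguerreWeight α x : ℂ))
        = fun x : ℝ => c * ((x ^ k * laguerreWeight α x : ℝ) : ℂ) := by
      funext x
      rw [eval_monomial]
      push_cast
      ring
    obtain ⟨h₁, h₂⟩ := hasIntegral_pow_mul_laguerreWeight hα k
    rw [h, laguerreMoment_monomial]
    exact ⟨h₁.ofReal.const_mul c, by
      rw [MeasureTheory.integral_const_mul, integral_complex_ofReal, h₂]⟩

end Moments

/-! ### Scalar differential operators -/

open Polynomial in
/-- The linear maps on `ℂ[X]` that, applied to every entry of a matrix polynomial, are given by a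
matrix differential operator. -/
noncomputable def scalarDiffOps (N : ℕ) : Subalgebra ℂ (Module.End ℂ ℂ[X]) where
  carrier := {φ | ∃ D : MatDiffOp N, ∀ P : MatPoly N, D.act P = P.map φ}
  mul_mem' := by
    rintro φ ψ ⟨D, hD⟩ ⟨E, hE⟩
    refine ⟨E.comp D, fun P => ?_⟩
    rw [MatDiffOp.act_comp, hE, hD]
    ext1 i j
    rfl
  add_mem' := by
    rintro φ ψ ⟨D, hD⟩ ⟨E, hE⟩
    refine ⟨D + E, fun P => ?_⟩
    rw [MatDiffOp.act_add, hD, hE]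
    ext1 i j
    rfl
  algebraMap_mem' c := by
    refine ⟨Finsupp.single 0 (Matrix.scalar _ (C c)), fun P => ?_⟩
    rw [MatDiffOp.act_single]
    ext1 i j
    simp [MatPoly.deriv, Polynomial.smul_eq_C_mul, mul_comm]

section ScalarOperators

open Polynomial

variable {N : ℕ}

theorem derivative_mem_scalarDiffOps : (derivative : ℂ[X] →ₗ[ℂ] ℂ[X]) ∈ scalarDiffOps N :=
  ⟨Finsupp.single 1 1, fun P => by rw [MatDiffOp.act_single, mul_one]; rfl⟩

theorem mulLeft_mem_scalarDiffOps (p : ℂ[X]) : LinearMap.mulLeft ℂ p ∈ scalarDiffOps N :=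
  ⟨Finsupp.single 0 (Matrix.scalar _ p), fun P => by
    rw [MatDiffOp.act_single]
    ext1 i j
    simp [MatPoly.deriv, mul_comm]⟩

/-- A matrix of scalar differential operators is a matrix differential operator. -/
theorem exists_matDiffOp_of_scalarDiffOps (φ : Fin N → Fin N → Module.End ℂ ℂ[X])
    (hφ : ∀ k j, φ k j ∈ scalarDiffOps N) :
    ∃ D : MatDiffOp N, ∀ (P : MatPoly N) i j, D.act P i j = ∑ k, φ k j (P i k) := by
  choose E hE using hφ
  refine ⟨∑ k, ∑ j, (E k j).comp (Finsupp.single 0 (Matrix.single k j 1)), fun P i j => ?_⟩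
  simp_rw [MatDiffOp.act_sum, MatDiffOp.act_comp, MatDiffOp.act_single, hE, Matrix.sum_apply]
  refine Finset.sum_congr rfl fun k _ => ?_
  rw [Finset.sum_eq_single j]
  · simp [MatPoly.deriv]
  · intro b _ hb
    exact Matrix.mul_single_apply_of_ne (hbj := hb.symm) ..
  · simp

/-- Multiplication of the Laguerre polynomials of parameter `α` by their degree. -/
theorem exists_degree_operator (α : ℝ) (s : ℂ[X]) :
    ∃ φ ∈ scalarDiffOps N, ∀ n, φ (monicLaguerre n α) = s.eval (n : ℂ) • monicLaguerre n α := by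
  obtain ⟨ν, hν, h⟩ : ∃ ν ∈ scalarDiffOps N, ∀ n : ℕ,
      ν (monicLaguerre n α) = (n : ℂ) • monicLaguerre n α := by
    refine ⟨-((LinearMap.mulLeft ℂ X * derivative + LinearMap.mulLeft ℂ (C ((α : ℂ) + 1) - X))
      * derivative), neg_mem (mul_mem (add_mem (mul_mem (mulLeft_mem_scalarDiffOps _)
        derivative_mem_scalarDiffOps) (mulLeft_mem_scalarDiffOps _))
        derivative_mem_scalarDiffOps), fun n => ?_⟩
    simp only [LinearMap.neg_apply, Module.End.mul_apply, LinearMap.add_apply,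
      LinearMap.mulLeft_apply, monicLaguerre.differential_equation, neg_neg, smul_eq_C_mul,
      map_natCast]
  exact ⟨aeval ν s, Algebra.adjoin_le (by simpa using hν) (aeval_mem_adjoin_singleton ℂ ν),
    fun n => Module.End.aeval_apply_of_mem_apply_eq_smul (h n)⟩

theorem exists_raise_parameter (γ : ℝ) (m : ℕ) :
    ∃ φ ∈ scalarDiffOps N, ∀ n, φ (monicLaguerre n γ) = monicLaguerre n (γ + m) := by
  induction m with
  | zero => exact ⟨1, one_mem _, fun n => by simp⟩
  | succ m ih =>
    obtain ⟨φ, hφ, h⟩ := ih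
    refine ⟨(1 - derivative) * φ, mul_mem (sub_mem (one_mem _) derivative_mem_scalarDiffOps) hφ,
      fun n => ?_⟩
    rw [Module.End.mul_apply, h, LinearMap.sub_apply, Module.End.one_apply,
      monicLaguerre.sub_derivative]
    push_cast
    rw [add_assoc]

/-- The polynomial `ρ_m(n) = (n + γ + 1) ⋯ (n + γ + m)`. It is the factor that arises when the
parameter `γ + m` is lowered to `γ`, and the ratio of the squared norms for these parameters. -/
noncomputable def normRatio (γ : ℝ) (m : ℕ) : ℂ[X] :=
  ∏ l ∈ Finset.range m, (X + C ((γ : ℂ) + l + 1))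

theorem normRatio_succ_eval (γ : ℝ) (m : ℕ) (z : ℂ) :
    (normRatio γ (m + 1)).eval z = (normRatio γ m).eval z * (z + γ + m + 1) := by
  rw [normRatio, Finset.prod_range_succ, eval_mul, eval_add, eval_X, eval_C, ← normRatio]
  ring

theorem exists_lower_parameter (γ : ℝ) (m : ℕ) :
    ∃ φ ∈ scalarDiffOps N, ∀ n,
      φ (monicLaguerre n (γ + m)) = (normRatio γ m).eval (n : ℂ) • monicLaguerre n γ := by
  induction m with
  | zero => exact ⟨1, one_mem _, fun n => by simp [normRatio]⟩
  | succ m ih =>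
    obtain ⟨φ, hφ, h⟩ := ih
    refine ⟨φ * (LinearMap.mulLeft ℂ X * derivative
      + LinearMap.mulLeft ℂ (C (((γ + m : ℝ) : ℂ) + 1))),
      mul_mem hφ (add_mem (mul_mem (mulLeft_mem_scalarDiffOps _) derivative_mem_scalarDiffOps)
        (mulLeft_mem_scalarDiffOps _)), fun n => ?_⟩
    rw [Nat.cast_succ, ← add_assoc]
    simp only [Module.End.mul_apply, LinearMap.add_apply, LinearMap.mulLeft_apply]
    rw [monicLaguerre.lower_parameter, ← smul_eq_C_mul, map_smul, h, smul_smul,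
      normRatio_succ_eval]
    congr 1
    push_cast
    ring

theorem exists_raise_degree (γ : ℝ) :
    ∃ φ ∈ scalarDiffOps N, ∀ n, φ (monicLaguerre n γ) = monicLaguerre (n + 1) γ := by
  refine ⟨-((LinearMap.mulLeft ℂ X * derivative + LinearMap.mulLeft ℂ (C ((γ : ℂ) + 1) - X))
      * (1 - derivative)), neg_mem (mul_mem (add_mem (mul_mem (mulLeft_mem_scalarDiffOps _)
        derivative_mem_scalarDiffOps) (mulLeft_mem_scalarDiffOps _))
        (sub_mem (one_mem _) derivative_mem_scalarDiffOps)), fun n => ?_⟩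
  simp only [LinearMap.neg_apply, Module.End.mul_apply, LinearMap.add_apply, LinearMap.sub_apply,
    Module.End.one_apply, LinearMap.mulLeft_apply, monicLaguerre.sub_derivative,
    monicLaguerre.raise, neg_neg]

theorem exists_lower_degree (γ : ℝ) :
    ∃ φ ∈ scalarDiffOps N, ∀ n : ℕ,
      φ (monicLaguerre n γ) = ((n : ℂ) * (n + γ)) • monicLaguerre (n - 1) γ := by
  refine ⟨(LinearMap.mulLeft ℂ X * derivative + LinearMap.mulLeft ℂ (C ((γ : ℂ) + 1))) * derivative,
    mul_mem (add_mem (mul_mem (mulLeft_mem_scalarDiffOps _) derivative_mem_scalarDiffOps)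
      (mulLeft_mem_scalarDiffOps _)) derivative_mem_scalarDiffOps, fun n => ?_⟩
  cases n with
  | zero => simp [monicLaguerre]
  | succ n =>
    simp only [Module.End.mul_apply]
    rw [monicLaguerre.derivative_succ, show ((n : ℂ[X]) + 1) = C ((n : ℂ) + 1) by simp,
      ← smul_eq_C_mul, map_smul]
    simp only [LinearMap.add_apply, Module.End.mul_apply, LinearMap.mulLeft_apply]
    rw [monicLaguerre.lower_parameter, ← smul_eq_C_mul, smul_smul]
    congr 1
    push_cast
    ring

theorem laguerreNorm_add (γ : ℝ) (hγ : -1 < γ) (m n : ℕ) :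
    (laguerreNorm (γ + m) n : ℂ) = (normRatio γ m).eval (n : ℂ) * laguerreNorm γ n := by
  induction m with
  | zero => simp [normRatio]
  | succ m ih =>
    have : (0 : ℝ) ≤ n := n.cast_nonneg
    have : (0 : ℝ) ≤ m := m.cast_nonneg
    have h : laguerreNorm (γ + (m + 1 : ℕ)) n = (n + γ + m + 1) * laguerreNorm (γ + m) n := by
      rw [laguerreNorm, laguerreNorm, Nat.cast_succ,
        show γ + ((m : ℝ) + 1) + n + 1 = (γ + m + n + 1) + 1 by ring,
        Real.Gamma_add_one (by linarith)]
      ring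
    rw [h, normRatio_succ_eval]
    push_cast
    rw [ih]
    ring

theorem laguerreNorm_succ {γ : ℝ} (hγ : -1 < γ) (n : ℕ) :
    laguerreNorm γ (n + 1) = (n + 1) * (n + 1 + γ) * laguerreNorm γ n := by
  have : (0 : ℝ) ≤ n := n.cast_nonneg
  rw [laguerreNorm, laguerreNorm, Nat.cast_succ,
    show γ + ((n : ℝ) + 1) + 1 = (γ + n + 1) + 1 by ring, Real.Gamma_add_one (by linarith),
    Nat.factorial_succ]
  push_cast
  ring

theorem normRatio_eval_ne_zero {γ : ℝ} (hγ : -1 < γ) (m n : ℕ) :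
    (normRatio γ m).eval (n : ℂ) ≠ 0 := by
  rw [normRatio, eval_prod, Finset.prod_ne_zero_iff]
  intro l _ h
  have h' : ((n + γ + l + 1 : ℝ) : ℂ) = 0 := by
    rw [← h, eval_add, eval_X, eval_C]
    push_cast
    ring
  have : (0 : ℝ) ≤ n := n.cast_nonneg
  have : (0 : ℝ) ≤ l := l.cast_nonneg
  have := Complex.ofReal_eq_zero.1 h'
  linarith

end ScalarOperators

/-! ### Matrix polynomials and their degrees -/

namespace MatPoly

open Polynomial

variable {N : ℕ}

theorem const_add (K L : Matrix (Fin N) (Fin N) ℂ) : const (K + L) = const K + const L := by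
  ext1 i j
  simp [const]

theorem const_neg (K : Matrix (Fin N) (Fin N) ℂ) : const (-K) = -const K := by
  ext1 i j
  simp [const]

theorem const_zero : const (0 : Matrix (Fin N) (Fin N) ℂ) = 0 := by
  ext1 i j
  simp [const]

theorem const_one : const (1 : Matrix (Fin N) (Fin N) ℂ) = 1 :=
  Matrix.map_one _ C_0 C_1

theorem const_mul (K L : Matrix (Fin N) (Fin N) ℂ) : const (K * L) = const K * const L :=
  Matrix.map_mul

theorem coeffMat_add (P Q : MatPoly N) (k : ℕ) :
    (P + Q).coeffMat k = P.coeffMat k + Q.coeffMat k := by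
  ext1 i j
  simp [coeffMat]

theorem coeffMat_const_mul (K : Matrix (Fin N) (Fin N) ℂ) (P : MatPoly N) (k : ℕ) :
    coeffMat (const K * P) k = K * P.coeffMat k := by
  ext1 i j
  simp [coeffMat, const, Matrix.mul_apply]

theorem eq_zero_of_coeffMat {P : MatPoly N} (h : ∀ k, P.coeffMat k = 0) : P = 0 := by
  ext i j k
  exact congrFun (congrFun (h k) i) j

/-- Subtracting a left multiple of a polynomial of regular degree `n` lowers the degree. -/
theorem exists_reduce {P Q : MatPoly N} {n : ℕ} (hQ : Q.HasRegularDegree n)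
    (hP : ∀ k, n < k → P.coeffMat k = 0) :
    ∃ K : Matrix (Fin N) (Fin N) ℂ, P.coeffMat n = K * Q.coeffMat n ∧
      ∀ k, n ≤ k → coeffMat (P + const (-K) * Q) k = 0 := by
  obtain ⟨u, hu⟩ := hQ.1
  have hK : P.coeffMat n = P.coeffMat n * (↑u⁻¹ : Matrix (Fin N) (Fin N) ℂ) * Q.coeffMat n := by
    rw [← hu, mul_assoc, Units.inv_mul, mul_one]
  refine ⟨_, hK, fun k hk => ?_⟩
  rw [coeffMat_add, coeffMat_const_mul]
  rcases hk.eq_or_lt with rfl | hk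
  · rw [neg_mul, ← hK, add_neg_cancel]
  · rw [hP k hk, hQ.2 k hk, mul_zero, add_zero]

theorem deriv_const_mul (K : Matrix (Fin N) (Fin N) ℂ) (P : MatPoly N) (j : ℕ) :
    deriv j (const K * P) = const K * deriv j P := by
  ext1 a b
  simp [deriv, const, Matrix.mul_apply, iterate_derivative_sum, iterate_derivative_C_mul]

end MatPoly

namespace MatDiffOp

open MatPoly

variable {N : ℕ}

theorem act_add_left (P Q : MatPoly N) (D : MatDiffOp N) :
    act (P + Q) D = act P D + act Q D := by
  simp only [act, deriv_add, add_mul, Finsupp.sum_add]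

theorem act_const_mul (K : Matrix (Fin N) (Fin N) ℂ) (P : MatPoly N) (D : MatDiffOp N) :
    act (const K * P) D = const K * act P D := by
  simp only [act, deriv_const_mul, mul_assoc, Finsupp.mul_sum]

theorem act_single_zero (P F : MatPoly N) : act P (Finsupp.single 0 F) = P * F := by
  rw [act_single]
  rfl

variable {Q R : ℕ → MatPoly N} {D : MatDiffOp N} {B : ℕ → Matrix (Fin N) (Fin N) ℂ}

/-- An operator that maps one sequence of polynomials of regular degree to left multiples of
another one does not raise degrees. -/
theorem coeffMat_act_eq_zero (hQ : ∀ n, (Q n).HasRegularDegree n)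
    (hR : ∀ n, (R n).HasRegularDegree n) (h : ∀ n, act (Q n) D = const (B n) * R n) (n : ℕ)
    (P : MatPoly N) (hP : ∀ k, n ≤ k → P.coeffMat k = 0) (k : ℕ) (hk : n ≤ k) :
    coeffMat (act P D) k = 0 := by
  induction n generalizing P k with
  | zero =>
    have : P = const 0 * P := by
      rw [const_zero, zero_mul]
      exact eq_zero_of_coeffMat fun k => hP k k.zero_le
    rw [this, act_const_mul, coeffMat_const_mul, zero_mul]
  | succ n ih =>
    obtain ⟨K, -, hK⟩ := exists_reduce (hQ n) hP
    have := ih _ hK k (by omega)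
    rw [act_add_left, act_const_mul, h, coeffMat_add, coeffMat_const_mul, coeffMat_const_mul,
      (hR n).2 k (by omega), mul_zero, mul_zero, add_zero] at this
    exact this

theorem isDegreePreserving_of_act_eq (hQ : ∀ n, (Q n).HasRegularDegree n)
    (hR : ∀ n, (R n).HasRegularDegree n) (h : ∀ n, act (Q n) D = const (B n) * R n)
    (hB : ∀ᶠ n in Filter.cofinite, IsUnit (B n)) : D.IsDegreePreserving := by
  filter_upwards [hB] with n hn P hP
  refine ⟨fun h₀ => hP.1 ?_, fun k hk => coeffMat_act_eq_zero hQ hR h (n + 1) P hP.2 k hk⟩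
  obtain ⟨K, hPK, hK⟩ := exists_reduce (hQ n) hP.2
  have := coeffMat_act_eq_zero hQ hR h n _ hK n le_rfl
  rw [act_add_left, act_const_mul, h, coeffMat_add, coeffMat_const_mul, coeffMat_const_mul, h₀,
    zero_add, neg_mul, neg_eq_zero, (hn.mul (hR n).1).mul_left_eq_zero] at this
  rw [hPK, this, zero_mul]

end MatDiffOp

/-! ### The shear `1 + X A` -/

open Polynomial in
/-- The matrix polynomial `1 + X A`, whose values for the zigzag matrix are `exp (x A)`. -/
noncomputable def MatPoly.shear {N : ℕ} (A : Matrix (Fin N) (Fin N) ℂ) : MatPoly N :=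
  1 + (X : ℂ[X]) • MatPoly.const A

namespace MatPoly

open Polynomial

variable {N : ℕ}

theorem shear_mul_shear_neg {A : Matrix (Fin N) (Fin N) ℂ} (hA : A * A = 0) :
    shear A * shear (-A) = 1 := by
  have h : const A * const A = 0 := by rw [← const_mul, hA, const_zero]
  have h' : ((X : ℂ[X]) • const A) * ((X : ℂ[X]) • const A) = 0 := by
    rw [smul_mul_smul_comm, h, smul_zero]
  rw [shear, shear, const_neg, smul_neg, add_mul, mul_add, mul_add, one_mul, one_mul, mul_one,
    mul_neg, h']
  abel

theorem coeffMat_mul_shear_zero (P : MatPoly N) (A : Matrix (Fin N) (Fin N) ℂ) :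
    coeffMat (P * shear A) 0 = P.coeffMat 0 := by
  rw [shear, mul_add, mul_one, mul_smul_comm, coeffMat_add]
  ext1 i j
  simp [coeffMat]

theorem coeffMat_mul_shear_succ (P : MatPoly N) (A : Matrix (Fin N) (Fin N) ℂ) (k : ℕ) :
    coeffMat (P * shear A) (k + 1) = P.coeffMat (k + 1) + P.coeffMat k * A := by
  rw [shear, mul_add, mul_one, mul_smul_comm, coeffMat_add]
  congr 1
  ext1 i j
  simp [coeffMat, const, Matrix.mul_apply]

theorem evalAt_mul (P Q : MatPoly N) (x : ℝ) : evalAt (P * Q) x = P.evalAt x * Q.evalAt x :=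
  Matrix.map_mul (f := evalRingHom (x : ℂ))

theorem evalAt_one (x : ℝ) : (1 : MatPoly N).evalAt x = 1 :=
  Matrix.map_one _ eval_zero eval_one

theorem evalAt_shear (A : Matrix (Fin N) (Fin N) ℂ) (x : ℝ) :
    (shear A).evalAt x = 1 + (x : ℂ) • A := by
  ext1 i j
  simp [evalAt, shear, const, Matrix.one_apply, apply_ite]
  exact mul_comm _ _

theorem conjTranspose_evalAt_apply (P : MatPoly N) (x : ℝ) (i j : Fin N) :
    (P.evalAt x).conjTranspose i j = ((P j i).map (starRingEnd ℂ)).eval (x : ℂ) := by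
  have := eval_map_apply (starRingEnd ℂ) (p := P j i) (x : ℂ)
  rw [Complex.conj_ofReal] at this
  rw [this]
  rfl

end MatPoly

/-! ### The inner product of the diagonal Laguerre weight -/

section DiagonalWeight

open Polynomial MatPoly
open scoped ComplexOrder

variable {N : ℕ}

theorem evalAt_mul_laguerreDiag_mul_apply (α : Fin N → ℝ) (P Q : MatPoly N) (x : ℝ)
    (i j : Fin N) :
    (P.evalAt x * laguerreDiag α x * (Q.evalAt x).conjTranspose) i j
      = ∑ k, (P i k * (Q j k).map (starRingEnd ℂ)).eval (x : ℂ) * (laguerreWeight (α k) x : ℂ) := by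
  rw [Matrix.mul_apply]
  refine Finset.sum_congr rfl fun k _ => ?_
  rw [laguerreDiag, Matrix.mul_diagonal, conjTranspose_evalAt_apply, eval_mul]
  simp only [evalAt, Matrix.map_apply]
  ring

theorem weightInner_laguerreDiag_apply {α : Fin N → ℝ} (hα : ∀ i, -1 < α i) (P Q : MatPoly N)
    (i j : Fin N) :
    weightInner (laguerreDiag α) P Q i j
      = ∑ k, laguerreMoment (α k) (P i k * (Q j k).map (starRingEnd ℂ)) := by
  simp only [weightInner, Matrix.of_apply, evalAt_mul_laguerreDiag_mul_apply]
  rw [MeasureTheory.integral_finsetSum _ fun k _ => (integral_eval_mul_laguerreWeight (hα k) _).1]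
  exact Finset.sum_congr rfl fun k _ => (integral_eval_mul_laguerreWeight (hα k) _).2

theorem weightInner_add_left {α : Fin N → ℝ} (hα : ∀ i, -1 < α i)
    (P P' Q : MatPoly N) :
    weightInner (laguerreDiag α) (P + P') Q
      = weightInner (laguerreDiag α) P Q + weightInner (laguerreDiag α) P' Q := by
  ext1 i j
  simp [weightInner_laguerreDiag_apply hα, add_mul, Finset.sum_add_distrib]

theorem weightInner_add_right {α : Fin N → ℝ} (hα : ∀ i, -1 < α i)
    (P Q Q' : MatPoly N) :
    weightInner (laguerreDiag α) P (Q + Q')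
      = weightInner (laguerreDiag α) P Q + weightInner (laguerreDiag α) P Q' := by
  ext1 i j
  simp [weightInner_laguerreDiag_apply hα, mul_add, Finset.sum_add_distrib]

theorem weightInner_const_mul_left {α : Fin N → ℝ} (hα : ∀ i, -1 < α i)
    (K : Matrix (Fin N) (Fin N) ℂ) (P Q : MatPoly N) :
    weightInner (laguerreDiag α) (const K * P) Q = K * weightInner (laguerreDiag α) P Q := by
  ext1 i j
  simp only [weightInner_laguerreDiag_apply hα, Matrix.mul_apply, const, Matrix.map_apply,
    Finset.sum_mul, map_sum, Finset.mul_sum]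
  rw [Finset.sum_comm]
  refine Finset.sum_congr rfl fun l _ => Finset.sum_congr rfl fun k _ => ?_
  rw [mul_assoc, ← smul_eq_C_mul, map_smul, smul_eq_mul]

theorem weightInner_const_mul_right {α : Fin N → ℝ} (hα : ∀ i, -1 < α i)
    (K : Matrix (Fin N) (Fin N) ℂ) (P Q : MatPoly N) :
    weightInner (laguerreDiag α) P (const K * Q)
      = weightInner (laguerreDiag α) P Q * K.conjTranspose := by
  ext1 i j
  simp only [weightInner_laguerreDiag_apply hα, Matrix.mul_apply, const, Matrix.map_apply,
    Finset.sum_mul, map_sum, Finset.mul_sum, Polynomial.map_sum, Polynomial.map_mul, map_C]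
  rw [Finset.sum_comm]
  refine Finset.sum_congr rfl fun l _ => Finset.sum_congr rfl fun k _ => ?_
  rw [mul_left_comm, ← smul_eq_C_mul, map_smul, smul_eq_mul, mul_comm]
  rfl

/-- The diagonal matrix of the monic Laguerre polynomials of degree `n`. -/
noncomputable def laguerreMat (α : Fin N → ℝ) (n : ℕ) : MatPoly N :=
  Matrix.diagonal fun i => monicLaguerre n (α i)

/-- The squared norm of `laguerreMat α n`. -/
noncomputable def laguerreNormMat (α : Fin N → ℝ) (n : ℕ) : Matrix (Fin N) (Fin N) ℂ :=
  Matrix.diagonal fun i => (laguerreNorm (α i) n : ℂ)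

theorem weightInner_laguerreMat {α : Fin N → ℝ} (hα : ∀ i, -1 < α i) (n m : ℕ) :
    weightInner (laguerreDiag α) (laguerreMat α n) (laguerreMat α m)
      = if n = m then laguerreNormMat α n else 0 := by
  ext1 i j
  have h := laguerreMoment_mul_monicLaguerre (hα i) n m
  rw [weightInner_laguerreDiag_apply hα, Finset.sum_eq_single i]
  · by_cases hij : i = j
    · subst hij
      simp only [laguerreMat, Matrix.diagonal_apply_eq, monicLaguerre.map_conj, h]
      split_ifs <;> simp [laguerreNormMat]
    · simp only [laguerreMat, Matrix.diagonal_apply_ne _ (Ne.symm hij), Polynomial.map_zero,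
        mul_zero, map_zero]
      split_ifs <;> simp [laguerreNormMat, Matrix.diagonal_apply_ne _ hij]
  · intro k _ hk
    simp [laguerreMat, Matrix.diagonal_apply_ne _ hk.symm]
  · simp

theorem coeffMat_laguerreMat (α : Fin N → ℝ) (n k : ℕ) :
    (laguerreMat α n).coeffMat k = Matrix.diagonal fun i => (monicLaguerre n (α i)).coeff k := by
  rw [coeffMat, laguerreMat, Matrix.diagonal_map (coeff_zero k)]

theorem coeffMat_laguerreMat_self (α : Fin N → ℝ) (n : ℕ) :
    (laguerreMat α n).coeffMat n = 1 := by
  simp [coeffMat_laguerreMat, monicLaguerre.coeff_self]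

theorem coeffMat_laguerreMat_of_lt (α : Fin N → ℝ) {n k : ℕ} (h : n < k) :
    (laguerreMat α n).coeffMat k = 0 := by
  simp [coeffMat_laguerreMat, monicLaguerre.coeff_of_lt _ h]

theorem isOrthogonalSequence_laguerreMat {α : Fin N → ℝ} (hα : ∀ i, -1 < α i) :
    IsOrthogonalSequence (laguerreDiag α) (laguerreMat α) where
  degree n := ⟨by rw [coeffMat_laguerreMat_self]; exact isUnit_one,
    fun _ hk => coeffMat_laguerreMat_of_lt α hk⟩
  orthogonal n m h := by rw [weightInner_laguerreMat hα, if_neg h]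

/-- Conjugating the diagonal Laguerre weight by an invertible matrix polynomial yields a weight
matrix. -/
theorem isWeightMatrix_conj {α : Fin N → ℝ} (hα : ∀ i, -1 < α i) {P P' : MatPoly N}
    (h : P * P' = 1) :
    IsWeightMatrix fun x => P.evalAt x * laguerreDiag α x * (P.evalAt x).conjTranspose := by
  refine ⟨0, ⊤, EReal.zero_lt_top, ?_, ?_, ?_⟩
  · refine Filter.Eventually.of_forall fun x hx _ => ?_
    have hx : 0 < x := by exact_mod_cast hx
    refine Matrix.PosDef.mul_mul_conjTranspose_same ?_ ?_
    · refine Matrix.PosDef.diagonal fun i => ?_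
      rw [laguerreWeight, if_pos hx]
      exact_mod_cast mul_pos (Real.exp_pos _) (Real.rpow_pos_of_pos hx _)
    · rw [Matrix.vecMul_injective_iff_isUnit]
      exact IsUnit.of_mul_eq_one (P'.evalAt x) (by rw [← evalAt_mul, h, evalAt_one])
  · intro x hx
    have hx : ¬ 0 < x := fun h => hx ⟨by exact_mod_cast h, EReal.coe_lt_top x⟩
    simp [laguerreDiag, laguerreWeight, hx]
  · intro n i j
    simp only [evalAt_mul_laguerreDiag_mul_apply, Finset.mul_sum]
    refine MeasureTheory.integrable_finsetSum _ fun k _ => ?_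
    have := (integral_eval_mul_laguerreWeight (hα k)
      (X ^ n * (P i k * (P j k).map (starRingEnd ℂ)))).1
    simpa only [eval_mul (p := X ^ n), eval_pow, eval_X, mul_assoc] using this

end DiagonalWeight

/-! ### The ladder operators of the diagonal weight -/

section Ladder

open Polynomial MatPoly

variable {N : ℕ}

/-- Matrix differential operators that shift the degree of `laguerreMat` by at most one. -/
theorem exists_ladder_operator (γ : ℝ) (m : Fin N → ℕ) (x : Fin N → ℂ[X])
    (s t : Fin N → Fin N → ℂ[X]) :
    ∃ D : MatDiffOp N, ∀ n : ℕ, D.act (laguerreMat (fun i => γ + m i) n)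
      = const (Matrix.diagonal fun i => (x i).eval (n : ℂ)) * laguerreMat (fun i => γ + m i) n
        + const (Matrix.of fun i j => (s i j).eval (n : ℂ) * (normRatio γ (m i)).eval (n : ℂ))
          * laguerreMat (fun i => γ + m i) (n + 1)
        + const (Matrix.of fun i j =>
            (t i j).eval (n : ℂ) * (n * (n + γ) * (normRatio γ (m i)).eval (n : ℂ)))
          * laguerreMat (fun i => γ + m i) (n - 1) := by
  choose ν hν hν' using fun i : Fin N => exists_degree_operator (N := N) (γ + m i) (x i)
  choose σ hσ hσ' using fun i j : Fin N => exists_degree_operator (N := N) (γ + m i) (s i j)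
  choose τ hτ hτ' using fun i j : Fin N => exists_degree_operator (N := N) (γ + m i) (t i j)
  choose u hu hu' using fun i : Fin N => exists_raise_parameter (N := N) γ (m i)
  choose d hd hd' using fun i : Fin N => exists_lower_parameter (N := N) γ (m i)
  obtain ⟨r, hr, hr'⟩ := exists_raise_degree (N := N) γ
  obtain ⟨l, hl, hl'⟩ := exists_lower_degree (N := N) γ
  -- The degree is changed at the common parameter `γ`, which all columns pass through.
  obtain ⟨D, hD⟩ := exists_matDiffOp_of_scalarDiffOps
    (fun i j => (if i = j then ν i else 0) + u j * r * d i * σ i j + u j * l * d i * τ i j)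
    (fun i j => add_mem (add_mem (by split_ifs; exacts [hν i, zero_mem _])
      (mul_mem (mul_mem (mul_mem (hu j) hr) (hd i)) (hσ i j)))
      (mul_mem (mul_mem (mul_mem (hu j) hl) (hd i)) (hτ i j)))
  refine ⟨D, fun n => ?_⟩
  ext1 i j
  rw [hD, Finset.sum_eq_single i]
  · simp only [Matrix.add_apply, laguerreMat, Matrix.mul_diagonal, const, Matrix.map_apply,
      Matrix.of_apply, Matrix.diagonal_apply_eq, LinearMap.add_apply, Module.End.mul_apply,
      hσ', hτ', map_smul, hd', hr', hl', hu', smul_smul, ← smul_eq_C_mul]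
    congr 2
    · by_cases h : i = j
      · subst h
        simp [hν']
      · simp [h]
    · congr 1
      ring
  · intro k _ hk
    rw [laguerreMat, Matrix.diagonal_apply_ne _ hk.symm, map_zero]
  · simp

end Ladder

/-! ### Matrices with a bipartite pattern -/

section Bipartite

open scoped ComplexOrder
open Matrix

variable {N : ℕ}

/-- All nonzero entries of `A` lie in a row with and a column without the property `p`. -/
def IsBipartite (p : Fin N → Prop) (A : Matrix (Fin N) (Fin N) ℂ) : Prop :=
  ∀ i j, A i j ≠ 0 → p i ∧ ¬ p j

variable {p : Fin N → Prop} {A : Matrix (Fin N) (Fin N) ℂ}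

theorem IsBipartite.mul_diagonal_mul (hA : IsBipartite p A) (d : Fin N → ℂ) :
    A * diagonal d * A = 0 := by
  ext i j
  rw [mul_apply, Matrix.zero_apply]
  refine Finset.sum_eq_zero fun k _ => ?_
  rw [mul_diagonal]
  by_cases h₁ : A i k = 0
  · rw [h₁, zero_mul, zero_mul]
  by_cases h₂ : A k j = 0
  · rw [h₂, mul_zero]
  exact absurd (hA k j h₂).1 (hA i k h₁).2

theorem IsBipartite.mul_self (hA : IsBipartite p A) : A * A = 0 := by
  simpa using hA.mul_diagonal_mul 1

theorem IsBipartite.conjTranspose (hA : IsBipartite p A) : IsBipartite (fun i => ¬ p i) Aᴴ :=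
  fun i j h => by
    have := hA j i (by simpa using h)
    exact ⟨this.2, fun h => h this.1⟩

/-- The matrix is `d (d⁻¹ + A^* e A)`, the product of two positive definite ones. -/
theorem isUnit_one_add_diagonal_mul (A : Matrix (Fin N) (Fin N) ℂ) {d e : Fin N → ℝ}
    (hd : ∀ i, 0 < d i) (he : ∀ i, 0 ≤ e i) :
    IsUnit (1 + diagonal (fun i => (d i : ℂ)) * Aᴴ * diagonal (fun i => (e i : ℂ)) * A) := by
  have h₁ : (diagonal fun i => (d i : ℂ)).PosDef :=
    PosDef.diagonal fun i => by exact_mod_cast hd i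
  have h₂ : (diagonal fun i => ((d i)⁻¹ : ℂ)).PosDef :=
    PosDef.diagonal fun i => by exact_mod_cast inv_pos.2 (hd i)
  have h₃ : (diagonal fun i => (e i : ℂ)).PosSemidef :=
    PosSemidef.diagonal fun i => by simpa using he i
  have h := h₁.isUnit.mul (h₂.add_posSemidef (h₃.conjTranspose_mul_mul_same A)).isUnit
  rw [mul_add, diagonal_mul_diagonal] at h
  convert h using 2
  · rw [← diagonal_one]
    congr 1
    funext i
    exact (mul_inv_cancel₀ (Complex.ofReal_ne_zero.2 (hd i).ne')).symm
  · simp only [mul_assoc]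

theorem isUnit_one_add_of_mul_self_eq_zero {Z : Matrix (Fin N) (Fin N) ℂ} (h : Z * Z = 0) :
    IsUnit (1 + Z) :=
  IsUnit.of_mul_eq_one (1 - Z) (by rw [add_mul, mul_sub, mul_sub, h]; simp)

end Bipartite

/-! ### Orthogonal polynomials for the weight `(1 + x A) diag(w) (1 + x A)^*` -/

section ShearedSequence

open MatPoly Matrix

variable {N : ℕ} {α : Fin N → ℝ} {p : Fin N → Prop} {A : Matrix (Fin N) (Fin N) ℂ}

/-- The inverse of the squared norm in degree `n - 1`, taken to be zero for `n = 0`. -/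
noncomputable def laguerreInvNorm (α : ℝ) : ℕ → ℝ
  | 0 => 0
  | n + 1 => (laguerreNorm α n)⁻¹

theorem laguerreInvNorm_nonneg {α : ℝ} (hα : -1 < α) (n : ℕ) : 0 ≤ laguerreInvNorm α n := by
  cases n with
  | zero => exact le_rfl
  | succ n => exact inv_nonneg.2 (laguerreNorm_pos hα n).le

/-- The diagonal matrix of the `laguerreInvNorm (α i) n`. -/
noncomputable def laguerreInvNormMat (α : Fin N → ℝ) (n : ℕ) : Matrix (Fin N) (Fin N) ℂ :=
  diagonal fun i => (laguerreInvNorm (α i) n : ℂ)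

theorem laguerreInvNormMat_zero (α : Fin N → ℝ) : laguerreInvNormMat α 0 = 0 := by
  simp [laguerreInvNormMat, laguerreInvNorm]

theorem laguerreNormMat_mul_inv (hα : ∀ i, -1 < α i) (n : ℕ) :
    laguerreNormMat α n * laguerreInvNormMat α (n + 1) = 1 := by
  rw [laguerreNormMat, laguerreInvNormMat, diagonal_mul_diagonal, ← diagonal_one]
  congr 1
  funext i
  have := (laguerreNorm_pos (hα i) n).ne'
  rw [laguerreInvNorm, ← Complex.ofReal_mul, mul_inv_cancel₀ this, Complex.ofReal_one]

theorem conjTranspose_laguerreNormMat (α : Fin N → ℝ) (n : ℕ) :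
    (laguerreNormMat α n)ᴴ = laguerreNormMat α n := by
  rw [laguerreNormMat, diagonal_conjTranspose]
  congr 1
  funext i
  exact Complex.conj_ofReal _

theorem conjTranspose_laguerreInvNormMat (α : Fin N → ℝ) (n : ℕ) :
    (laguerreInvNormMat α n)ᴴ = laguerreInvNormMat α n := by
  rw [laguerreInvNormMat, diagonal_conjTranspose]
  congr 1
  funext i
  exact Complex.conj_ofReal _

/-- The coefficient `-H_n A^* H_{n-1}⁻¹` of the Laguerre polynomials of degree `n - 1` in
`shearedLaguerre`. -/
noncomputable def shearedCoeff (α : Fin N → ℝ) (A : Matrix (Fin N) (Fin N) ℂ) (n : ℕ) :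
    Matrix (Fin N) (Fin N) ℂ :=
  -(laguerreNormMat α n * Aᴴ * laguerreInvNormMat α n)

/-- The product of the `n`-th orthogonal polynomial for the weight `T diag(w) T^*` with
`T = 1 + X A`. It is a combination of Laguerre polynomials of degrees `n - 1`, `n` and `n + 1`. -/
noncomputable def shearedLaguerre (α : Fin N → ℝ) (A : Matrix (Fin N) (Fin N) ℂ) (n : ℕ) :
    MatPoly N :=
  laguerreMat α n + const A * laguerreMat α (n + 1)
    + const (shearedCoeff α A n) * laguerreMat α (n - 1)

theorem shearedCoeff_zero (α : Fin N → ℝ) (A : Matrix (Fin N) (Fin N) ℂ) :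
    shearedCoeff α A 0 = 0 := by
  rw [shearedCoeff, laguerreInvNormMat_zero, mul_zero, neg_zero]

theorem conjTranspose_shearedCoeff (α : Fin N → ℝ) (A : Matrix (Fin N) (Fin N) ℂ) (n : ℕ) :
    (shearedCoeff α A n)ᴴ = -(laguerreInvNormMat α n * A * laguerreNormMat α n) := by
  rw [shearedCoeff, conjTranspose_neg, conjTranspose_mul, conjTranspose_mul,
    conjTranspose_conjTranspose, conjTranspose_laguerreNormMat, conjTranspose_laguerreInvNormMat,
    mul_assoc]

theorem laguerreNormMat_mul_conjTranspose_shearedCoeff (hα : ∀ i, -1 < α i) (n : ℕ) :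
    laguerreNormMat α n * (shearedCoeff α A (n + 1))ᴴ = -(A * laguerreNormMat α (n + 1)) := by
  rw [conjTranspose_shearedCoeff, mul_neg, ← mul_assoc, ← mul_assoc, laguerreNormMat_mul_inv hα,
    one_mul]

theorem shearedCoeff_mul_laguerreNormMat (hα : ∀ i, -1 < α i) (n : ℕ) :
    shearedCoeff α A (n + 1) * laguerreNormMat α n = -(laguerreNormMat α (n + 1) * Aᴴ) := by
  have : laguerreInvNormMat α (n + 1) * laguerreNormMat α n = 1 :=
    mul_eq_one_comm.1 (laguerreNormMat_mul_inv hα n)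
  rw [shearedCoeff, neg_mul, mul_assoc, this, mul_one]

theorem IsBipartite.mul_shearedCoeff_mul (hA : IsBipartite p A) (hα : ∀ i, -1 < α i) (n : ℕ) :
    A * (laguerreNormMat α n * (shearedCoeff α A (n + 1))ᴴ) = 0 := by
  rw [laguerreNormMat_mul_conjTranspose_shearedCoeff hα, mul_neg, ← mul_assoc, hA.mul_self,
    zero_mul, neg_zero]

theorem IsBipartite.shearedCoeff_mul_conjTranspose (hA : IsBipartite p A)
    (hα : ∀ i, -1 < α i) (n : ℕ) :
    shearedCoeff α A (n + 1) * (laguerreNormMat α n * Aᴴ) = 0 := by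
  rw [← mul_assoc, shearedCoeff_mul_laguerreNormMat hα, neg_mul, mul_assoc,
    hA.conjTranspose.mul_self, mul_zero, neg_zero]

theorem weightInner_shearedLaguerre (hA : IsBipartite p A) (hα : ∀ i, -1 < α i) {n m : ℕ}
    (hnm : n ≠ m) :
    weightInner (laguerreDiag α) (shearedLaguerre α A n) (shearedLaguerre α A m) = 0 := by
  simp only [shearedLaguerre, weightInner_add_left hα, weightInner_add_right hα,
    weightInner_const_mul_left hα, weightInner_const_mul_right hα, weightInner_laguerreMat hα]
  have h₁ := hA.mul_shearedCoeff_mul hα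
  have h₂ := hA.shearedCoeff_mul_conjTranspose hα
  have h₃ := laguerreNormMat_mul_conjTranspose_shearedCoeff (A := A) hα
  have h₄ := shearedCoeff_mul_laguerreNormMat (A := A) hα
  have h₀ := shearedCoeff_zero α A
  rcases lt_trichotomy (n + 1) m with h | rfl | h
  · -- Here only `m = n + 2` contributes a term, which vanishes by the pattern of `A`.
    obtain ⟨m, rfl⟩ : ∃ m', m = m' + 1 := ⟨m - 1, by omega⟩
    simp only [if_neg hnm, if_neg (show n ≠ m + 1 + 1 by omega), Nat.add_sub_cancel,
      if_neg (show n ≠ m by omega), if_neg (show n + 1 ≠ m + 1 by omega),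
      if_neg (show n + 1 ≠ m + 1 + 1 by omega), if_neg (show n - 1 ≠ m + 1 by omega),
      if_neg (show n - 1 ≠ m + 1 + 1 by omega), if_neg (show n - 1 ≠ m by omega), zero_mul,
      mul_zero, add_zero, zero_add]
    split_ifs with h'
    · rw [h', h₁]
    · simp
  · -- The two contributions in neighbouring degrees cancel.
    simp only [if_neg hnm, Nat.add_sub_cancel, if_true, if_neg (show n ≠ n + 1 + 1 by omega),
      if_neg (show n + 1 ≠ n by omega), if_neg (show n + 1 ≠ n + 1 + 1 by omega),
      if_neg (show n - 1 ≠ n + 1 by omega), if_neg (show n - 1 ≠ n + 1 + 1 by omega), zero_mul,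
      mul_zero, add_zero, zero_add, h₃]
    cases n with
    | zero => simp [h₀]
    | succ n => simp
  · have h : m < n := by omega
    obtain ⟨n, rfl⟩ : ∃ n', n = n' + 1 := ⟨n - 1, by omega⟩
    simp only [if_neg hnm, Nat.add_sub_cancel, if_neg (show n + 1 + 1 ≠ m by omega),
      if_neg (show n + 1 + 1 ≠ m + 1 by omega), if_neg (show n + 1 ≠ m - 1 by omega),
      if_neg (show n + 1 + 1 ≠ m - 1 by omega), zero_mul, mul_zero, add_zero, zero_add]
    rcases eq_or_ne n m with rfl | h'
    · simp only [if_true, if_neg (show n ≠ n + 1 by omega), h₄, zero_mul, mul_zero]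
      cases n with
      | zero => simp [h₀]
      | succ n => simp
    · simp only [if_neg h', if_neg (show n + 1 ≠ m + 1 by omega), if_neg (show n ≠ m - 1 by omega),
        zero_mul, mul_zero, zero_add, add_zero]
      split_ifs with h''
      · rw [h₂]
      · simp

/-- The orthogonal polynomials for the weight `T diag(w) T^*` with `T = 1 + X A`. -/
noncomputable def shearedSequence (α : Fin N → ℝ) (A : Matrix (Fin N) (Fin N) ℂ) (n : ℕ) :
    MatPoly N :=
  shearedLaguerre α A n * shear (-A)

theorem coeffMat_shearedLaguerre (n k : ℕ) :
    (shearedLaguerre α A n).coeffMat k = (laguerreMat α n).coeffMat k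
      + A * (laguerreMat α (n + 1)).coeffMat k
      + shearedCoeff α A n * (laguerreMat α (n - 1)).coeffMat k := by
  simp only [shearedLaguerre, coeffMat_add, coeffMat_const_mul]

theorem shearedCoeff_mul_coeffMat_eq_zero {n k : ℕ} (h : n ≤ k) :
    shearedCoeff α A n * (laguerreMat α (n - 1)).coeffMat k = 0 := by
  cases n with
  | zero => rw [shearedCoeff_zero, zero_mul]
  | succ n => rw [coeffMat_laguerreMat_of_lt α (by omega), mul_zero]

theorem isUnit_one_sub_shearedCoeff_mul (hα : ∀ i, -1 < α i) (n : ℕ) :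
    IsUnit (1 - shearedCoeff α A n * A) := by
  rw [shearedCoeff, neg_mul, sub_neg_eq_add]
  exact isUnit_one_add_diagonal_mul A (fun i => laguerreNorm_pos (hα i) n)
    (fun i => laguerreInvNorm_nonneg (hα i) n)

theorem hasRegularDegree_shearedSequence (hA : IsBipartite p A) (hα : ∀ i, -1 < α i) (n : ℕ) :
    (shearedSequence α A n).HasRegularDegree n := by
  constructor
  · cases n with
    | zero =>
      rw [shearedSequence, coeffMat_mul_shear_zero, coeffMat_shearedLaguerre,
        coeffMat_laguerreMat_self, shearedCoeff_zero, zero_mul, add_zero]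
      refine isUnit_one_add_of_mul_self_eq_zero ?_
      rw [← mul_assoc, coeffMat_laguerreMat, hA.mul_diagonal_mul, zero_mul]
    | succ n =>
      rw [shearedSequence, coeffMat_mul_shear_succ, coeffMat_shearedLaguerre,
        coeffMat_shearedLaguerre, Nat.add_sub_cancel, coeffMat_laguerreMat_self,
        coeffMat_laguerreMat_of_lt α (Nat.lt_succ_self n), mul_zero, coeffMat_laguerreMat_self,
        mul_one, add_zero]
      have h₁ : ∀ l k, A * (laguerreMat α l).coeffMat k * A = 0 := fun l k => by
        rw [coeffMat_laguerreMat, hA.mul_diagonal_mul]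
      set L := (laguerreMat α (n + 1 + 1)).coeffMat (n + 1) with hL
      set L' := (laguerreMat α (n + 1)).coeffMat n with hL'
      set F := shearedCoeff α A (n + 1)
      -- The leading coefficient is the product of an invertible and a unipotent matrix.
      have h₂ : IsUnit (1 + (A * L - L' * A)) := by
        refine isUnit_one_add_of_mul_self_eq_zero ?_
        have e : (A * L - L' * A) * (A * L - L' * A)
            = (A * L * A) * L - A * (L * L') * A - L' * (A * A) * L + L' * (A * L' * A) := by
          noncomm_ring
        rw [e, hL, hL', h₁, h₁, hA.mul_self, coeffMat_laguerreMat, coeffMat_laguerreMat,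
          diagonal_mul_diagonal, hA.mul_diagonal_mul]
        simp
      have h₃ := (isUnit_one_sub_shearedCoeff_mul (A := A) hα (n + 1)).mul h₂
      convert h₃ using 1
      have e : (1 - F * A) * (1 + (A * L - L' * A))
          = 1 + A * L + (L' + A * (laguerreMat α (n + 1 + 1)).coeffMat n + F) * -A
            - F * (A * A) * L + F * (A * L' * A)
            + A * (laguerreMat α (n + 1 + 1)).coeffMat n * A := by
        noncomm_ring
      rw [e, hA.mul_self, hL', h₁, h₁]
      simp
  · intro k hk
    obtain ⟨k, rfl⟩ : ∃ k', k = k' + 1 := ⟨k - 1, by omega⟩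
    have h₁ : A * (laguerreMat α (n + 1)).coeffMat k * A = 0 := by
      rw [coeffMat_laguerreMat, hA.mul_diagonal_mul]
    rw [shearedSequence, coeffMat_mul_shear_succ, coeffMat_shearedLaguerre,
      coeffMat_shearedLaguerre, shearedCoeff_mul_coeffMat_eq_zero (by omega),
      shearedCoeff_mul_coeffMat_eq_zero (by omega), coeffMat_laguerreMat_of_lt α hk, mul_neg,
      add_zero, add_zero, zero_add, add_mul, h₁, add_zero]
    rcases (Nat.lt_succ_iff.1 hk).eq_or_lt with rfl | hk
    · rw [coeffMat_laguerreMat_self, coeffMat_laguerreMat_self, mul_one, one_mul, add_neg_cancel]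
    · rw [coeffMat_laguerreMat_of_lt α hk, coeffMat_laguerreMat_of_lt α (by omega)]
      simp

/-- The map `P ↦ P T` with `T = 1 + X A` is an isometry to the diagonal weight. -/
theorem weightInner_sheared (P Q : MatPoly N) :
    weightInner (fun x => (shear A).evalAt x * laguerreDiag α x * ((shear A).evalAt x)ᴴ) P Q
      = weightInner (laguerreDiag α) (P * shear A) (Q * shear A) := by
  simp only [weightInner, evalAt_mul, conjTranspose_mul, mul_assoc]

theorem shearedSequence_mul_shear (hA : IsBipartite p A) (n : ℕ) :
    shearedSequence α A n * shear A = shearedLaguerre α A n := by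
  have h : shear (-A) * shear A = 1 := by
    simpa using shear_mul_shear_neg (A := -A) (by simp [hA.mul_self])
  rw [shearedSequence, mul_assoc, h, mul_one]

theorem isOrthogonalSequence_shearedSequence (hA : IsBipartite p A) (hα : ∀ i, -1 < α i) :
    IsOrthogonalSequence
      (fun x => (shear A).evalAt x * laguerreDiag α x * ((shear A).evalAt x)ᴴ)
      (shearedSequence α A) where
  degree := hasRegularDegree_shearedSequence hA hα
  orthogonal n m h := by
    rw [weightInner_sheared, shearedSequence_mul_shear hA, shearedSequence_mul_shear hA,
      weightInner_shearedLaguerre hA hα h]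

end ShearedSequence

/-! ### The Darboux factorization -/

section Factorization

open Polynomial MatPoly Matrix MatDiffOp

variable {N : ℕ}

/-- The entries of `shearedCoeff` become polynomial in `n` when the factor `normRatio γ l (n - 1)`
is cleared. -/
theorem laguerreNorm_mul_invNorm {γ : ℝ} (hγ : -1 < γ) (k l n : ℕ) :
    (laguerreNorm (γ + k) n : ℂ) * laguerreInvNorm (γ + l) n
        * (normRatio γ l).eval ((n : ℂ) - 1)
      = n * (n + γ) * (normRatio γ k).eval (n : ℂ) := by
  cases n with
  | zero => simp [laguerreInvNorm]
  | succ n =>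
    have h₁ : (laguerreNorm γ n : ℂ) ≠ 0 :=
      Complex.ofReal_ne_zero.2 (laguerreNorm_pos hγ n).ne'
    have h₂ := normRatio_eval_ne_zero hγ l n
    rw [laguerreInvNorm, Complex.ofReal_inv, laguerreNorm_add γ hγ, laguerreNorm_add γ hγ,
      laguerreNorm_succ hγ]
    push_cast
    rw [add_sub_cancel_right]
    field_simp

open Classical in
/-- The polynomials in the degree `n` by which the rows of `shearedLaguerre` have to be multiplied
to be images of Laguerre polynomials under a differential operator. The factor for the rows
outside `p` is a multiple of all denominators `normRatio γ (m k) (n - 1)` that occur there. -/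
noncomputable def rowFactor (p : Fin N → Prop) (γ : ℝ) (m : Fin N → ℕ) (i : Fin N) : ℂ[X] :=
  if p i then normRatio γ (m i) else (∏ k, normRatio γ (m k)).comp (X - 1)

/-- The diagonal matrix of the values of `rowFactor` at `n`. -/
noncomputable def rowFactorMat (p : Fin N → Prop) (γ : ℝ) (m : Fin N → ℕ) (n : ℕ) :
    Matrix (Fin N) (Fin N) ℂ :=
  diagonal fun i => (rowFactor p γ m i).eval (n : ℂ)

variable {p : Fin N → Prop} {A : Matrix (Fin N) (Fin N) ℂ} {γ : ℝ} {m : Fin N → ℕ}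

theorem eval_rowFactor_of_pos {i : Fin N} (h : p i) (z : ℂ) :
    (rowFactor p γ m i).eval z = (normRatio γ (m i)).eval z := by
  rw [rowFactor, if_pos h]

theorem eval_rowFactor_of_neg {i : Fin N} (h : ¬ p i) (z : ℂ) :
    (rowFactor p γ m i).eval z = ∏ k, (normRatio γ (m k)).eval (z - 1) := by
  rw [rowFactor, if_neg h, eval_comp, eval_prod]
  simp

theorem isUnit_rowFactorMat (hγ : -1 < γ) (n : ℕ) : IsUnit (rowFactorMat p γ m (n + 1)) := by
  rw [rowFactorMat, isUnit_diagonal, Pi.isUnit_iff]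
  refine fun i => IsUnit.mk0 _ ?_
  by_cases h : p i
  · rw [eval_rowFactor_of_pos h]
    exact normRatio_eval_ne_zero hγ _ _
  · rw [eval_rowFactor_of_neg h, Finset.prod_ne_zero_iff]
    intro k _
    push_cast
    rw [add_sub_cancel_right]
    exact normRatio_eval_ne_zero hγ _ _

theorem eventually_isUnit_rowFactorMat (hγ : -1 < γ) :
    ∀ᶠ n in Filter.cofinite, IsUnit (rowFactorMat p γ m n) := by
  rw [Nat.cofinite_eq_atTop]
  filter_upwards [Filter.eventually_ge_atTop 1] with n hn
  obtain ⟨k, rfl⟩ := Nat.exists_eq_add_of_le' hn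
  exact isUnit_rowFactorMat hγ k

theorem shearedCoeff_apply (α : Fin N → ℝ) (n : ℕ) (i j : Fin N) :
    shearedCoeff α A n i j
      = -((laguerreNorm (α i) n : ℂ) * star (A j i) * laguerreInvNorm (α j) n) := by
  rw [shearedCoeff, neg_apply, laguerreInvNormMat, mul_diagonal, laguerreNormMat, diagonal_mul,
    conjTranspose_apply]

/-- The operator that maps the Laguerre polynomials to multiples of `shearedLaguerre`. -/
theorem exists_shearing_operator (hA : IsBipartite p A) (hγ : -1 < γ) :
    ∃ D : MatDiffOp N, ∀ n, act (laguerreMat (fun i => γ + m i) n) D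
      = const (rowFactorMat p γ m n) * shearedLaguerre (fun i => γ + m i) A n := by
  classical
  obtain ⟨D, hD⟩ := exists_ladder_operator γ m (rowFactor p γ m) (fun i j => C (A i j))
    (fun i j => -(C (star (A j i)) * (∏ k ∈ Finset.univ.erase j, normRatio γ (m k)).comp (X - 1)))
  refine ⟨D, fun n => ?_⟩
  rw [hD, shearedLaguerre, mul_add (const _), mul_add (const _), ← mul_assoc (const _) (const A),
    ← mul_assoc (const _) (const _), ← const_mul, ← const_mul]
  congr 3
  · congr 1
    ext i j
    rw [rowFactorMat, diagonal_mul, of_apply, eval_C]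
    by_cases h : A i j = 0
    · rw [h, zero_mul, mul_zero]
    · rw [eval_rowFactor_of_pos (hA i j h).1, mul_comm]
  · ext i j
    rw [rowFactorMat, diagonal_mul, of_apply, shearedCoeff_apply]
    by_cases h : A j i = 0
    · simp [h]
    · rw [eval_rowFactor_of_neg (hA j i h).2, ← Finset.mul_prod_erase _ _ (Finset.mem_univ j),
        ← laguerreNorm_mul_invNorm hγ (m i) (m j) n]
      simp only [eval_neg, eval_mul, eval_C, eval_comp, eval_prod, eval_sub, eval_X, eval_one]
      ring

/-- The operator that maps `shearedLaguerre` back to multiples of the Laguerre polynomials, given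
by its values on the latter. These values are those of the formal adjoint of the shearing
operator. -/
theorem exists_unshearing_operator (hA : IsBipartite p A) (hγ : -1 < γ) :
    ∃ D : MatDiffOp N, ∀ n, act (laguerreMat (fun i => γ + m i) n) D
      = const (rowFactorMat p γ m n) * laguerreMat (fun i => γ + m i) n
        + const (-(A * rowFactorMat p γ m (n + 1))) * laguerreMat (fun i => γ + m i) (n + 1)
        + const (-(shearedCoeff (fun i => γ + m i) A n * rowFactorMat p γ m (n - 1)))
          * laguerreMat (fun i => γ + m i) (n - 1) := by
  classical
  obtain ⟨D, hD⟩ := exists_ladder_operator γ m (rowFactor p γ m)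
    (fun i j => -(C (A i j) * ∏ k ∈ Finset.univ.erase i, normRatio γ (m k)))
    (fun i j => C (star (A j i)))
  refine ⟨D, fun n => ?_⟩
  rw [hD]
  congr 3
  · congr 1
    ext i j
    rw [rowFactorMat, neg_apply, mul_diagonal, of_apply]
    by_cases h : A i j = 0
    · simp [h]
    · rw [eval_rowFactor_of_neg (hA i j h).2, Nat.cast_succ, add_sub_cancel_right,
        ← Finset.mul_prod_erase _ _ (Finset.mem_univ i)]
      simp only [eval_neg, eval_mul, eval_C, eval_prod]
      ring
  · ext i j
    rw [rowFactorMat, neg_apply, mul_diagonal, of_apply, shearedCoeff_apply, eval_C]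
    by_cases h : A j i = 0
    · simp [h]
    · rw [eval_rowFactor_of_pos (hA j i h).1, ← laguerreNorm_mul_invNorm hγ (m i) (m j) n]
      cases n with
      | zero => simp [laguerreInvNorm]
      | succ n =>
        rw [Nat.add_sub_cancel, Nat.cast_succ, add_sub_cancel_right]
        ring

theorem IsBipartite.shearedCoeff_mul_shearedCoeff (hA : IsBipartite p A) (α : Fin N → ℝ)
    (n k : ℕ) : shearedCoeff α A n * shearedCoeff α A k = 0 := by
  have h : Aᴴ * (laguerreInvNormMat α n * laguerreNormMat α k) * Aᴴ = 0 := by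
    rw [laguerreInvNormMat, laguerreNormMat, diagonal_mul_diagonal,
      hA.conjTranspose.mul_diagonal_mul]
  rw [shearedCoeff, shearedCoeff, neg_mul_neg]
  calc _ = laguerreNormMat α n * (Aᴴ * (laguerreInvNormMat α n * laguerreNormMat α k) * Aᴴ)
        * laguerreInvNormMat α k := by noncomm_ring
    _ = 0 := by rw [h, mul_zero, zero_mul]

theorem isUnit_one_sub_mul_shearedCoeff {α : Fin N → ℝ} (hα : ∀ i, -1 < α i) (n : ℕ) :
    IsUnit (1 - A * shearedCoeff α A n) := by
  rw [isUnit_iff_isUnit_det, det_one_sub_mul_comm, ← isUnit_iff_isUnit_det]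
  exact isUnit_one_sub_shearedCoeff_mul hα n

/-- The left factor that the unshearing operator produces on `shearedLaguerre`. -/
noncomputable def unshearingFactor (p : Fin N → Prop) (A : Matrix (Fin N) (Fin N) ℂ) (γ : ℝ)
    (m : Fin N → ℕ) (n : ℕ) : Matrix (Fin N) (Fin N) ℂ :=
  (1 - A * shearedCoeff (fun i => γ + m i) A (n + 1))
    * (1 - shearedCoeff (fun i => γ + m i) A n * A) * rowFactorMat p γ m n

theorem act_shearedLaguerre (hA : IsBipartite p A) {D : MatDiffOp N}
    (hD : ∀ n, act (laguerreMat (fun i => γ + m i) n) D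
      = const (rowFactorMat p γ m n) * laguerreMat (fun i => γ + m i) n
        + const (-(A * rowFactorMat p γ m (n + 1))) * laguerreMat (fun i => γ + m i) (n + 1)
        + const (-(shearedCoeff (fun i => γ + m i) A n * rowFactorMat p γ m (n - 1)))
          * laguerreMat (fun i => γ + m i) (n - 1)) (n : ℕ) :
    act (shearedLaguerre (fun i => γ + m i) A n) D
      = const (unshearingFactor p A γ m n) * laguerreMat (fun i => γ + m i) n := by
  have hAA : const A * const A = 0 := by rw [← const_mul, hA.mul_self, const_zero]
  have hFF : ∀ k l, const (shearedCoeff (fun i => γ + m i) A k)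
      * const (shearedCoeff (fun i => γ + m i) A l) = 0 := fun k l => by
    rw [← const_mul, hA.shearedCoeff_mul_shearedCoeff, const_zero]
  have hsub : ∀ K : Matrix (Fin N) (Fin N) ℂ, const (1 - K) = 1 - const K := fun K => by
    rw [sub_eq_add_neg, const_add, const_neg, const_one, sub_eq_add_neg]
  have hlow : const (shearedCoeff (fun i => γ + m i) A n)
        * act (laguerreMat (fun i => γ + m i) (n - 1)) D
      = const (shearedCoeff (fun i => γ + m i) A n)
        * (const (rowFactorMat p γ m (n - 1)) * laguerreMat (fun i => γ + m i) (n - 1)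
          - const A * const (rowFactorMat p γ m n) * laguerreMat (fun i => γ + m i) n) := by
    cases n with
    | zero => rw [shearedCoeff_zero, const_zero, zero_mul, zero_mul]
    | succ n =>
      rw [Nat.add_sub_cancel, hD]
      simp only [const_mul, const_neg, mul_add, neg_mul, mul_neg, mul_sub]
      rw [← mul_assoc (const (shearedCoeff _ A (n + 1))) (const (shearedCoeff _ A n) * _),
        ← mul_assoc (const (shearedCoeff _ A (n + 1))) (const (shearedCoeff _ A n)), hFF, zero_mul,
        zero_mul, neg_zero, add_zero, sub_eq_add_neg]
  rw [shearedLaguerre, act_add_left, act_add_left, act_const_mul, act_const_mul, hlow, hD, hD,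
    unshearingFactor, Nat.add_sub_cancel]
  simp only [const_mul, const_neg, hsub]
  have hFF' := hFF (n + 1) n
  generalize laguerreMat (fun i => γ + m i) n = M
  generalize laguerreMat (fun i => γ + m i) (n + 1) = M₁
  generalize laguerreMat (fun i => γ + m i) (n + 1 + 1) = M₂
  generalize laguerreMat (fun i => γ + m i) (n - 1) = M₀
  generalize const (rowFactorMat p γ m n) = c
  generalize const (rowFactorMat p γ m (n + 1)) = c₁
  generalize const (rowFactorMat p γ m (n + 1 + 1)) = c₂
  generalize const (rowFactorMat p γ m (n - 1)) = c₀
  generalize const (shearedCoeff (fun i => γ + m i) A n) = F at *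
  generalize const (shearedCoeff (fun i => γ + m i) A (n + 1)) = F₁ at *
  generalize const A = a at *
  have e : c * M + -(a * c₁) * M₁ + -(F * c₀) * M₀
        + a * (c₁ * M₁ + -(a * c₂) * M₂ + -(F₁ * c) * M) + F * (c₀ * M₀ - a * c * M)
      = (1 - a * F₁) * (1 - F * a) * c * M - (a * a) * c₂ * M₂ - a * (F₁ * F) * a * c * M := by
    noncomm_ring
  rw [e, hAA, hFF']
  simp

/-- The sheared weight is a Darboux transformation of the diagonal Laguerre weight whose parameters
differ by natural numbers from a common one. -/
theorem isDarbouxTransformation_sheared (hA : IsBipartite p A) (hγ : -1 < γ) :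
    IsDarbouxTransformation
      (fun x => (shear A).evalAt x * laguerreDiag (fun i => γ + m i) x * ((shear A).evalAt x)ᴴ)
      (laguerreDiag fun i => γ + m i) := by
  have hα : ∀ i, -1 < γ + (m i : ℝ) := fun i => by
    have : (0 : ℝ) ≤ m i := (m i).cast_nonneg
    linarith
  obtain ⟨E₁, hE₁⟩ := exists_shearing_operator (m := m) hA hγ
  obtain ⟨E₂, hE₂⟩ := exists_unshearing_operator (m := m) hA hγ
  have hQ := isOrthogonalSequence_laguerreMat hα
  have hR := isOrthogonalSequence_shearedSequence hA hα
  have h₁ : ∀ n, act (laguerreMat (fun i => γ + m i) n)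
      (E₁.comp (Finsupp.single 0 (shear (-A))))
      = const (rowFactorMat p γ m n) * shearedSequence (fun i => γ + m i) A n := fun n => by
    rw [act_comp, hE₁, act_single_zero, mul_assoc, shearedSequence]
  have h₂ : ∀ n, act (shearedSequence (fun i => γ + m i) A n)
      (comp (Finsupp.single 0 (shear A)) E₂)
      = const (unshearingFactor p A γ m n) * laguerreMat (fun i => γ + m i) n := fun n => by
    rw [act_comp, act_single_zero, shearedSequence_mul_shear hA, act_shearedLaguerre hA hE₂]
  refine ⟨isWeightMatrix_conj hα (shear_mul_shear_neg hA.mul_self), ?_, _, ⟨_, hQ,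
      fun n => rowFactorMat p γ m n * unshearingFactor p A γ m n, fun n => ?_⟩, _, _, rfl,
    isDegreePreserving_of_act_eq hQ.degree hR.degree h₁ (eventually_isUnit_rowFactorMat hγ),
    isDegreePreserving_of_act_eq hR.degree hQ.degree h₂ ?_, _, _, hQ, hR, _, h₁⟩
  · simpa [evalAt_one] using isWeightMatrix_conj hα (mul_one (1 : MatPoly N))
  · rw [act_comp, h₁, act_const_mul, h₂, const_mul, mul_assoc]
  · filter_upwards [eventually_isUnit_rowFactorMat (p := p) (m := m) hγ] with n hn
    exact ((isUnit_one_sub_mul_shearedCoeff hα _).mul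
      (isUnit_one_sub_shearedCoeff_mul hα _)).mul hn

end Factorization

/-! ### The zigzag matrix -/

theorem isBipartite_zigzagMatrix (N : ℕ) (a : ℕ → ℝ) :
    IsBipartite (fun i : Fin N => i.val % 2 = 0) (zigzagMatrix N a) := by
  intro r c h
  simp only [zigzagMatrix, Matrix.of_apply] at h
  split_ifs at h with h₁ h₂
  · constructor <;> omega
  · constructor <;> omega
  · exact absurd rfl h

/-- Real numbers with integral differences exceed the smallest of them by natural numbers. -/
theorem exists_eq_add_natCast {N : ℕ} {α : Fin N → ℝ} (hα : ∀ i, -1 < α i)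
    (hint : ∀ i j, ∃ m : ℤ, α i - α j = m) :
    ∃ (γ : ℝ) (m : Fin N → ℕ), -1 < γ ∧ α = fun i => γ + m i := by
  rcases isEmpty_or_nonempty (Fin N) with h | h
  · exact ⟨0, fun _ => 0, by norm_num, Subsingleton.elim _ _⟩
  obtain ⟨i₀, h₀⟩ := Finite.exists_min α
  choose k hk using fun i => hint i i₀
  refine ⟨α i₀, fun i => (k i).toNat, hα i₀, funext fun i => ?_⟩
  have : 0 ≤ k i := by
    have := h₀ i
    exact_mod_cast (hk i) ▸ sub_nonneg.2 this
  have h₁ : (((k i).toNat : ℤ) : ℝ) = k i := by rw [Int.toNat_of_nonneg this]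
  rw [Int.cast_natCast] at h₁
  rw [h₁, ← hk]
  ring

theorem mainTheorem3 (N : ℕ) (α : Fin N → ℝ) (hα : ∀ i, -1 < α i)
    (hint : ∀ i j, ∃ m : ℤ, α i - α j = m)
    (a : ℕ → ℝ) (ha : ∀ j, 1 ≤ j → j < N → a j ≠ 0) :
    IsDarbouxTransformation (laguerreTypeWeight α a) (laguerreDiag α) := by
  obtain ⟨γ, m, hγ, rfl⟩ := exists_eq_add_natCast hα hint
  have h := isDarbouxTransformation_sheared (m := m) (isBipartite_zigzagMatrix N a) hγ
  simp only [MatPoly.evalAt_shear, ← zigzagExp_eq] at h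
  exact h
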